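/- Let $P\subseteq Q\subseteq\mathbb{R}^d$ be rational polytopes (convex hulls of finitely many points of $\mathbb{Q}^d$) of the same dimension $D=\dim P=\dim Q$. The denominator $\delta(P)$ is the smallest positive integer $q$ such that $qP$ has vertices in $\mathbb{Z}^d$ (and $\delta(\emptyset)=1$), and $\mathrm{C}(P)=\{c(p,1)\mid c\ge 0,\ p\in P\}\subseteq\mathbb{R}^{d+1}$. Let $S_Q$ be the semiring of all finite sums of products $c\,\ell_1\cdots\ell_k$ ($c\ge 0$ real, $k\ge 0$, $\ell_1,\dots,\ell_k$ real linear forms in $d+1$ variables), where each product $\ell_1\cdots\ell_k$ is nonnegative on $Q\times\{1\}$. Let $w\in S_Q$ be homogeneous of degree $m$. For $K\in\{P,Q\}$ put $$\mathrm{Ehr}(K,w;t)=\sum_{x\in \mathrm{C}(K)\cap\mathbb{Z}^{d+1}}w(x)\,t^{x_{d+1}},\qquad h^*_{K,w}(t)=(1-t^{\delta(K)})^{D+m+1}\,\mathrm{Ehr}(K,w;t).$$ Then $h^*_{P,w}$ and $h^*_{Q,w}$ are polynomials, of degree at most $\delta(P)(D+m+1)-1$ and $\delta(Q)(D+m+1)-1$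 respectively, and for every positive common multiple $g$ of $\delta(P)$ and $\delta(Q)$, $$(1+t^{\delta(P)}+\cdots+t^{g-\delta(P)})^{D+m+1}\,h^*_{P,w}(t)\ \le\ (1+t^{\delta(Q)}+\cdots+t^{g-\delta(Q)})^{D+m+1}\,h^*_{Q,w}(t)\qquad\text{for all real } t\ge 0.$$ In particular, if $\delta(P)=\delta(Q)$, then $h^*_{P,w}(t)\le h^*_{Q,w}(t)$ for all $t\ge 0$. -/

import Mathlib

namespace WeightedEhrhart

noncomputable section

/-- The point `(p, 1)` of `ℝ^(d+1)`. -/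
def lift {d : ℕ} (p : Fin d → ℝ) : Fin (d + 1) → ℝ :=
  Fin.snoc (α := fun _ => ℝ) p 1

/-- A rational polytope in `ℝ^d`: the convex hull of finitely many (possibly no) points with
rational coordinates. -/
def IsRationalPolytope {d : ℕ} (P : Set (Fin d → ℝ)) : Prop :=
  ∃ V : Finset (Fin d → ℚ),
    P = convexHull ℝ ((fun (v : Fin d → ℚ) (i : Fin d) => (v i : ℝ)) '' (V : Set (Fin d → ℚ)))

/-- The dimension of a polytope, i.e. that of its affine hull. The value at the empty polytope
is `0`; it is irrelevant there because the Ehrhart series of the empty polytope is `0`. -/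
def polytopeDim {d : ℕ} (P : Set (Fin d → ℝ)) : ℕ :=
  Module.finrank ℝ (vectorSpan ℝ P)

/-- The denominator `δ(P)`: the smallest positive integer `q` such that `q P` has vertices in
`ℤ^d`. The vertices of `q P` are the points `q v` with `v` a vertex (extreme point) of `P`.
The empty polytope has denominator `1`. -/
def denominator {d : ℕ} (P : Set (Fin d → ℝ)) : ℕ :=
  sInf {q : ℕ | 0 < q ∧ ∀ v ∈ P.extremePoints ℝ, ∀ i : Fin d, ∃ z : ℤ, (q : ℝ) * v i = (z : ℝ)}

/-- The cone over `P` (homogenization), `C(P) = {c (p, 1) | c ≥ 0, p ∈ P} ⊆ ℝ^(d+1)`. -/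
def cone {d : ℕ} (P : Set (Fin d → ℝ)) : Set (Fin (d + 1) → ℝ) :=
  {y | ∃ c : ℝ, 0 ≤ c ∧ ∃ p ∈ P, y = c • lift p}

/-- The weighted Ehrhart series `Ehr(P, w; t) = ∑ w(x) t^(x_(d+1))`, the sum being over
`x ∈ C(P) ∩ ℤ^(d+1)`, as a formal power series: the coefficient of `t^n` is the (finite) sum of
`w(x)` over those `x` whose last coordinate is `n`. -/
def ehrhartSeries {d : ℕ} (P : Set (Fin d → ℝ)) (w : MvPolynomial (Fin (d + 1)) ℝ) :
    PowerSeries ℝ :=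
  PowerSeries.mk fun n =>
    ∑ᶠ x ∈ {x : Fin (d + 1) → ℤ | (fun i => (x i : ℝ)) ∈ cone P ∧ x (Fin.last d) = (n : ℤ)},
      MvPolynomial.eval (fun i => (x i : ℝ)) w

/-- `h` is the weighted `h^*`-polynomial of `P`, that is,
`Ehr(P, w; t) = h(t) / (1 - t^q)^(r + m + 1)` with `r = dim P`, `m = deg w`, `q = δ(P)`. -/
def IsHStar {d : ℕ} (P : Set (Fin d → ℝ)) (w : MvPolynomial (Fin (d + 1)) ℝ)
    (h : Polynomial ℝ) : Prop :=
  (h : PowerSeries ℝ) =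
    (1 - PowerSeries.X ^ denominator P) ^ (polytopeDim P + w.totalDegree + 1) *
      ehrhartSeries P w

/-- The weighted `h^*`-polynomial of `P`: the numerator of `Ehr(P, w; t)` over
`(1 - t^q)^(r + m + 1)`, a polynomial of degree at most `q (r + m + 1) - 1`. It is defined by
truncation above that degree; that nothing is lost is `IsHStar P w (hStar P w)`. -/
def hStar {d : ℕ} (P : Set (Fin d → ℝ)) (w : MvPolynomial (Fin (d + 1)) ℝ) : Polynomial ℝ :=
  PowerSeries.trunc (denominator P * (polytopeDim P + w.totalDegree + 1))
    ((1 - PowerSeries.X ^ denominator P) ^ (polytopeDim P + w.totalDegree + 1) *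
      ehrhartSeries P w)

/-- The semiring `S_P`: sums of nonnegative products `c ℓ₁ ⋯ ℓₖ` (`c ≥ 0` real, `k ≥ 0`) of linear
forms on `ℝ^(d+1)`, each product being nonnegative on `P`, viewed as `P × {1}` (the single forms
`ℓᵢ` may change sign on `P`). The factor `c` only matters for `k = 0`: it makes the nonnegative
constants belong to `S_P`. -/
def semiringS {d : ℕ} (P : Set (Fin d → ℝ)) : AddSubmonoid (MvPolynomial (Fin (d + 1)) ℝ) :=
  AddSubmonoid.closure
    {p | ∃ (c : ℝ) (k : ℕ) (ℓ : Fin k → MvPolynomial (Fin (d + 1)) ℝ),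
      0 ≤ c ∧ (∀ i, (ℓ i).IsHomogeneous 1) ∧
      (∀ x ∈ P, 0 ≤ MvPolynomial.eval (lift x) (∏ i, ℓ i)) ∧
      p = MvPolynomial.C c * ∏ i, ℓ i}

/-- `1 + t^a + t^(2a) + ⋯ + t^(g - a)` for a positive multiple `g` of `a`. -/
def geomFactor (a g : ℕ) (t : ℝ) : ℝ :=
  ∑ j ∈ Finset.range (g / a), t ^ (a * j)

end

end WeightedEhrhart

/-! Put N = D + m + 1. For 0 ≤ t < 1 both sides of the inequality are (1 - t^g)^N times an Ehrhart
series, and the coefficients for P are at most those for Q, because C(P) ⊆ C(Q) and w ≥ 0 on C(Q)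
(`cone_nonneg`, `coeff_levelSeries_mono`, `eval_nonneg_of_numerator`). Continuity gives t = 1. For t
> 1 the inequality is pulled back to 1/t: by weighted reciprocity the reversed h*-polynomial is the
numerator of the series of interior lattice points, and these series are ordered in the same way.

The interior is described as the set of x with x - εξ in the cone for some ε > 0. A single ξ in
C(P), generic for the vertices of both polytopes, serves P and Q; it exists because equal dimensions
give both cones the same span. This description is monotone in the polytope and suits half-open
decompositions.

Reciprocity (`weighted_reciprocity`) is proved with difference operators. A regular triangulation
splits the cone into half-open simplicial cones. For each of them, the indicator minus the signed,
reflected indicator of the oppositely half-open cone is a difference of two products of step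
functions with equal differences, so one difference along each generator kills it. A weight of
degree m costs m more differences on level sums (`bdiff_pow_fiberSum_eq_zero`). Thus N differences
annihilate a two-sided sequence, which yields polynomiality, the degree bound and the reversed
numerator at once (`numerator_of_reciprocity`). -/

namespace WeightedEhrhart

open Filter Topology Module

/-! ### Regular triangulations of a pointed cone by linear programming. -/

section Triangulation

set_option linter.unusedSectionVars false

variable {ι V : Type*} [Fintype ι] [NormedAddCommGroup V] [NormedSpace ℝ V]

/-- The convex cone generated by a finite family of vectors. -/
def posCone (u : ι → V) : Set V := {x | ∃ a : ι → ℝ, (∀ i, 0 ≤ a i) ∧ ∑ i, a i • u i = x}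

/-- A vector is generic for a family if it avoids every proper subspace spanned by members. -/
def Generic (u : ι → V) (y : V) : Prop :=
  ∀ S : Set ι, Submodule.span ℝ (u '' S) ≠ ⊤ → y ∉ Submodule.span ℝ (u '' S)

/-- The subsets of a family that index a basis of the whole space. -/
abbrev Cell (u : ι → V) : Type _ :=
  {B : Finset ι // LinearIndependent ℝ (fun i : B => u i) ∧
    ⊤ ≤ Submodule.span ℝ (Set.range fun i : B => u i)}

noncomputable instance (u : ι → V) : Fintype (Cell u) := by
  classical
  unfold Cell
  infer_instance

/-- The basis belonging to a cell. -/
noncomputable def Cell.basis {u : ι → V} (B : Cell u) : Basis B.1 ℝ V :=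
  Basis.mk B.2.1 B.2.2

lemma Cell.basis_apply {u : ι → V} (B : Cell u) (i : B.1) : B.basis i = u i := by
  simp [Cell.basis]

lemma posCone_add {u : ι → V} {x y : V} (hx : x ∈ posCone u) (hy : y ∈ posCone u) :
    x + y ∈ posCone u := by
  obtain ⟨a, ha, rfl⟩ := hx
  obtain ⟨b, hb, rfl⟩ := hy
  exact ⟨a + b, fun i => add_nonneg (ha i) (hb i), by simp [add_smul, Finset.sum_add_distrib]⟩

lemma posCone_smul {u : ι → V} {x : V} (hx : x ∈ posCone u) {c : ℝ} (hc : 0 ≤ c) :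
    c • x ∈ posCone u := by
  obtain ⟨a, ha, rfl⟩ := hx
  exact ⟨c • a, fun i => mul_nonneg hc (ha i), by simp [Finset.smul_sum, mul_smul]⟩

lemma mem_posCone_of_coord_nonneg {u : ι → V} (B : Cell u) {x : V}
    (hx : ∀ i, 0 ≤ B.basis.coord i x) : x ∈ posCone u := by
  classical
  refine ⟨fun i => if h : i ∈ B.1 then B.basis.coord ⟨i, h⟩ x else 0, fun i => ?_, ?_⟩
  · dsimp only
    split_ifs with h
    exacts [hx _, le_rfl]
  · rw [← Finset.sum_subset (Finset.subset_univ B.1)]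
    · rw [← Finset.sum_attach]
      conv_rhs => rw [← B.basis.sum_repr x]
      exact Finset.sum_congr rfl fun i _ => by simp [B.basis_apply]
    · intro i _ hi
      simp [hi]

lemma Generic.coord_ne_zero {u : ι → V} {y : V} (hy : Generic u y) (B : Cell u) (i : B.1) :
    B.basis.coord i y ≠ 0 := by
  intro h0
  have hle : Submodule.span ℝ (u '' ((B.1 : Set ι) \ {i.1})) ≤ LinearMap.ker (B.basis.coord i) := by
    rw [Submodule.span_le]
    rintro _ ⟨j, ⟨hj, hji⟩, rfl⟩
    have : u j = B.basis ⟨j, hj⟩ := (B.basis_apply ⟨j, hj⟩).symm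
    rw [this]
    have hne : (⟨j, hj⟩ : B.1) ≠ i := fun h => hji (by simp [← h])
    simp [hne]
  refine hy ((B.1 : Set ι) \ {i.1}) ?_ ?_
  · intro htop
    rw [htop] at hle
    have : B.basis i ∈ LinearMap.ker (B.basis.coord i) := hle trivial
    simp at this
  · rw [← B.basis.sum_repr y]
    refine Submodule.sum_mem _ fun j _ => ?_
    by_cases hj : j = i
    · subst hj
      rw [Basis.coord_apply] at h0
      rw [h0, zero_smul]
      exact Submodule.zero_mem _
    · refine Submodule.smul_mem _ _ (Submodule.subset_span ⟨j, ⟨j.2, ?_⟩, (B.basis_apply j).symm⟩)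
      exact fun h => hj (Subtype.ext h)

lemma exists_cell_subset {u : ι → V} {S : Set ι} (hS : Submodule.span ℝ (u '' S) = ⊤) :
    ∃ B : Cell u, (B.1 : Set ι) ⊆ S := by
  classical
  obtain ⟨b, hbS, -, hspan, hli⟩ := exists_linearIndepOn_extension (K := ℝ) (v := u)
    (linearIndepOn_empty ℝ u) (Set.empty_subset S)
  have e : ((b.toFinset : Finset ι) : Set ι) = b := by simp
  refine ⟨⟨b.toFinset, ?_, ?_⟩, by simpa using hbS⟩
  · have : LinearIndepOn ℝ u (b.toFinset : Set ι) := by rwa [e]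
    exact this
  · have : Set.range (fun i : b.toFinset => u i) = u '' b := by
      rw [← e]
      ext
      simp
    rw [this, ← hS]
    exact Submodule.span_le.2 hspan

/-- The linear functional taking prescribed values on the members of a cell. -/
noncomputable def Cell.dual {u : ι → V} (B : Cell u) (ω : ι → ℝ) : V →ₗ[ℝ] ℝ :=
  B.basis.constr ℝ fun i => ω i

lemma Cell.dual_apply {u : ι → V} (B : Cell u) (ω : ι → ℝ) {i : ι} (hi : i ∈ B.1) :
    B.dual ω (u i) = ω i := by
  have : u i = B.basis ⟨i, hi⟩ := (B.basis_apply ⟨i, hi⟩).symm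
  rw [this, Cell.dual, Basis.constr_basis]

/-- The kernel direction that raises the coordinate `j` and compensates inside a cell. -/
noncomputable def Cell.dir {u : ι → V} (B : Cell u) (j : ι) : ι → ℝ := by
  classical
  exact Pi.single j 1 - ∑ i : B.1, B.basis.coord i (u j) • Pi.single i.1 1

lemma Cell.sum_dir_mul {u : ι → V} (B : Cell u) (j : ι) {W : Type*} [AddCommGroup W] [Module ℝ W]
    (f : ι → W) :
    ∑ i, B.dir j i • f i = f j - ∑ i : B.1, B.basis.coord i (u j) • f i := by
  classical
  have h : ∀ z : ι → ℝ, ∑ i, z i • f i = Fintype.linearCombination ℝ f z := fun z => by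
    simp [Fintype.linearCombination_apply]
  rw [h, Cell.dir, map_sub, map_sum]
  simp only [map_smul, Fintype.linearCombination_apply_single, one_smul]

lemma Cell.sum_dir_smul {u : ι → V} (B : Cell u) (j : ι) : ∑ i, B.dir j i • u i = 0 := by
  rw [B.sum_dir_mul, sub_eq_zero]
  conv_lhs => rw [← B.basis.sum_repr (u j)]
  simp [B.basis_apply]

/-- This is the reduced cost of the simplex method: the change of cost when `u j` enters and the
cell compensates. -/
lemma Cell.sum_dir_cost {u : ι → V} (B : Cell u) (ω : ι → ℝ) (j : ι) :
    ∑ i, B.dir j i * ω i = ω j - B.dual ω (u j) := by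
  have := B.sum_dir_mul j ω
  simp only [smul_eq_mul] at this
  rw [this]
  conv_rhs => rw [← B.basis.sum_repr (u j)]
  rw [map_sum]
  congr 1
  refine Finset.sum_congr rfl fun i _ => ?_
  rw [map_smul, B.basis_apply, B.dual_apply ω i.2]
  simp

open Classical in
lemma Cell.dir_of_notMem {u : ι → V} (B : Cell u) {j i : ι} (hi : i ∉ B.1) :
    B.dir j i = if i = j then 1 else 0 := by
  have h : ∀ k : B.1, (Pi.single (k : ι) (1 : ℝ) : ι → ℝ) i = 0 := fun k =>
    Pi.single_eq_of_ne (fun h : i = k => hi (by rw [h]; exact k.2)) _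
  simp [Cell.dir, h, Pi.single_apply]

/-- A cost vector is nondegenerate if no cell prices a further vector exactly. -/
def Nondegenerate (u : ι → V) (ω : ι → ℝ) : Prop :=
  ∀ (B : Cell u) (j : ι), j ∉ B.1 → B.dual ω (u j) ≠ ω j

/-- The finitely many directions `B.dir j` with `j ∉ B` are nonzero, so some functional vanishes on
none of them; its values on the standard basis are the costs. -/
lemma exists_nondegenerate (u : ι → V) : ∃ ω : ι → ℝ, Nondegenerate u ω := by
  classical
  obtain ⟨f, hf⟩ := Module.exists_dual_forall_apply_ne_zero (K := ℝ)
    (fun p : {p : Cell u × ι // p.2 ∉ p.1.1} => p.1.1.dir p.1.2) (by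
      rintro ⟨⟨B, j⟩, hj⟩ h
      have := congrFun h j
      simp [B.dir_of_notMem hj] at this)
  refine ⟨fun i => f (Pi.single i 1), fun B j hj h => hf ⟨(B, j), hj⟩ ?_⟩
  have hz : ∀ z : ι → ℝ, f z = ∑ i, z i * f (Pi.single i 1) := fun z => by
    conv_lhs => rw [pi_eq_sum_univ' z]
    simp only [map_sum, map_smul, smul_eq_mul]
  have := B.sum_dir_cost (fun i => f (Pi.single i 1)) j
  rw [h, sub_self, ← hz] at this
  exact this

lemma exists_min_cost (u : ι → V) (l : V →ₗ[ℝ] ℝ) (hl : ∀ i, l (u i) = 1) (ω : ι → ℝ) {y : V}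
    (hy : y ∈ posCone u) :
    ∃ a : ι → ℝ, (∀ i, 0 ≤ a i) ∧ ∑ i, a i • u i = y ∧
      ∀ b : ι → ℝ, (∀ i, 0 ≤ b i) → ∑ i, b i • u i = y → ∑ i, a i * ω i ≤ ∑ i, b i * ω i := by
  classical
  set F : Set (ι → ℝ) := {a | (∀ i, 0 ≤ a i) ∧ ∑ i, a i • u i = y} with hF
  have hclosed : IsClosed F := by
    have h1 : IsClosed {a : ι → ℝ | ∀ i, 0 ≤ a i} := by
      simp only [Set.ofPred_forall]
      exact isClosed_iInter fun i => isClosed_le continuous_const (continuous_apply i)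
    have h2 : IsClosed {a : ι → ℝ | ∑ i, a i • u i = y} :=
      isClosed_eq (by fun_prop) continuous_const
    exact h1.inter h2
  -- Applying `l` shows that the coefficients sum to `l y`, so the feasible set is bounded.
  have hsub : F ⊆ Set.Icc (fun _ => 0) (fun _ => l y) := by
    rintro a ⟨ha, rfl⟩
    refine ⟨ha, fun i => ?_⟩
    simp only [map_sum, map_smul, hl, smul_eq_mul, mul_one]
    exact Finset.single_le_sum (fun j _ => ha j) (Finset.mem_univ i)
  have hcomp : IsCompact F := isCompact_Icc.of_isClosed_subset hclosed hsub
  obtain ⟨a, ⟨ha, hay⟩, hmin⟩ := hcomp.exists_isMinOn hy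
    (f := fun a => ∑ i, a i * ω i) (by fun_prop)
  exact ⟨a, ha, hay, fun b hb hby => hmin ⟨hb, hby⟩⟩

lemma eventually_add_smul_nonneg {a z : ι → ℝ} (ha : ∀ i, 0 ≤ a i)
    (hz : ∀ i, a i = 0 → 0 ≤ z i) : ∀ᶠ ε in 𝓝[>] (0 : ℝ), ∀ i, 0 ≤ a i + ε * z i := by
  rw [eventually_all]
  intro i
  rcases (ha i).eq_or_lt with h | h
  · filter_upwards [self_mem_nhdsWithin] with ε hε
    rw [← h, zero_add]
    exact mul_nonneg (le_of_lt hε) (hz i h.symm)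
  · have : Tendsto (fun ε => a i + ε * z i) (𝓝[>] 0) (𝓝 (a i + 0 * z i)) :=
      (Continuous.tendsto (by fun_prop) 0).mono_left nhdsWithin_le_nhds
    rw [zero_mul, add_zero] at this
    exact (this.eventually (lt_mem_nhds h)).mono fun _ h => h.le

/-- First-order optimality: such a `z` is a feasible direction at the minimizer `a`. -/
lemma cost_nonneg_of_min {u : ι → V} {ω a : ι → ℝ} (ha : ∀ i, 0 ≤ a i)
    (hmin : ∀ b : ι → ℝ, (∀ i, 0 ≤ b i) → ∑ i, b i • u i = ∑ i, a i • u i →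
      ∑ i, a i * ω i ≤ ∑ i, b i * ω i)
    {z : ι → ℝ} (hz : ∑ i, z i • u i = 0) (hz0 : ∀ i, a i = 0 → 0 ≤ z i) :
    0 ≤ ∑ i, z i * ω i := by
  obtain ⟨ε, hε, hpos⟩ := ((eventually_add_smul_nonneg ha hz0).and self_mem_nhdsWithin).exists
  have := hmin (fun i => a i + ε * z i) hε (by
    simp [add_smul, Finset.sum_add_distrib, mul_smul, ← Finset.smul_sum, hz])
  simp only [add_mul, Finset.sum_add_distrib, mul_assoc, ← Finset.mul_sum] at this
  have h : 0 ≤ ε * ∑ i, z i * ω i := by linarith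
  exact nonneg_of_mul_nonneg_right h hpos

open Classical in
/-- The cells of the regular triangulation induced by a cost vector. -/
noncomputable def regularCells (u : ι → V) (ω : ι → ℝ) : Finset (Cell u) :=
  {B | ∀ j ∉ B.1, B.dual ω (u j) < ω j}

/-- The cell is a basis inside the support of a cheapest representation of `y`. Genericity makes the
support span, optimality gives the dual inequalities, and nondegeneracy makes them strict and forces
the support into the cell. -/
lemma exists_regularCell {u : ι → V} {l : V →ₗ[ℝ] ℝ} (hl : ∀ i, l (u i) = 1) {ω : ι → ℝ}
    (hω : Nondegenerate u ω) {y : V} (hgen : Generic u y) (hy : y ∈ posCone u) :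
    ∃ B ∈ regularCells u ω, ∀ i, 0 < B.basis.coord i y := by
  classical
  obtain ⟨a, ha, rfl, hmin⟩ := exists_min_cost u l hl ω hy
  set S : Set ι := {i | a i ≠ 0} with hS
  have hspan : Submodule.span ℝ (u '' S) = ⊤ := by
    by_contra hne
    refine hgen S hne (Submodule.sum_mem _ fun i _ => ?_)
    by_cases hi : a i = 0
    · simp [hi]
    · exact Submodule.smul_mem _ _ (Submodule.subset_span ⟨i, hi, rfl⟩)
  obtain ⟨B, hB⟩ := exists_cell_subset hspan
  have hdir : ∀ j i, a i = 0 → B.dir j i = if i = j then 1 else 0 := fun j i hi =>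
    B.dir_of_notMem fun h => hB h hi
  have hle : ∀ j, B.dual ω (u j) ≤ ω j := fun j => by
    have := cost_nonneg_of_min ha hmin (B.sum_dir_smul j) (fun i hi => by
      rw [hdir j i hi]; split_ifs <;> norm_num)
    rw [B.sum_dir_cost] at this
    linarith
  have hzero : ∀ j, j ∉ B.1 → a j = 0 := fun j hj => by
    by_contra haj
    -- With `a j` positive the direction is feasible with either sign, so the reduced cost would be
    -- zero.
    have := cost_nonneg_of_min ha hmin (z := - B.dir j)
      (by simp [B.sum_dir_smul j]) (fun i hi => by
        have : i ≠ j := fun h => haj (h ▸ hi)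
        simp [hdir j i hi, this])
    simp only [Pi.neg_apply, neg_mul, Finset.sum_neg_distrib, B.sum_dir_cost] at this
    exact hω B j hj (le_antisymm (hle j) (by linarith))
  refine ⟨B, by simpa [regularCells] using fun j hj => lt_of_le_of_ne (hle j) (hω B j hj),
    fun i => ?_⟩
  refine lt_of_le_of_ne ?_ (hgen.coord_ne_zero B i).symm
  rw [map_sum]
  refine Finset.sum_nonneg fun j _ => ?_
  rw [map_smul, smul_eq_mul]
  by_cases hj : j ∈ B.1
  · have : u j = B.basis ⟨j, hj⟩ := (B.basis_apply ⟨j, hj⟩).symm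
    rw [this, Basis.coord_apply, Basis.repr_self, Finsupp.single_apply]
    split_ifs <;> simp [ha]
  · simp [hzero j hj]

/-- Each dual functional lies below `ω` and agrees with it on its own cell, so both take the same
value at `y`. An index of `C` outside `B` would make one comparison strict. -/
lemma regularCell_unique {u : ι → V} {ω : ι → ℝ} {y : V} {B C : Cell u}
    (hB : B ∈ regularCells u ω) (hC : C ∈ regularCells u ω)
    (hBy : ∀ i, 0 < B.basis.coord i y) (hCy : ∀ i, 0 < C.basis.coord i y) : C.1 ⊆ B.1 := by
  classical
  simp only [regularCells, Finset.mem_filter, Finset.mem_univ, true_and] at hB hC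
  have hle : ∀ {B : Cell u}, (∀ j ∉ B.1, B.dual ω (u j) < ω j) → ∀ j, B.dual ω (u j) ≤ ω j := by
    intro B h j
    by_cases hj : j ∈ B.1
    · exact (B.dual_apply ω hj).le
    · exact (h j hj).le
  have key : ∀ {B C : Cell u}, (∀ j ∉ B.1, B.dual ω (u j) < ω j) →
      (∀ i, 0 < C.basis.coord i y) → B.dual ω y ≤ C.dual ω y := by
    intro B C hB hCy
    rw [← C.basis.sum_repr y, map_sum, map_sum]
    refine Finset.sum_le_sum fun i _ => ?_
    rw [map_smul, map_smul, C.basis_apply, C.dual_apply ω i.2]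
    exact mul_le_mul_of_nonneg_left (hle hB _) (hCy i).le
  have heq : B.dual ω y = C.dual ω y := le_antisymm (key hB hCy) (key hC hBy)
  intro j hj
  by_contra hjB
  refine heq.not_lt ?_
  rw [← C.basis.sum_repr y, map_sum, map_sum]
  refine Finset.sum_lt_sum (fun i _ => ?_) ⟨⟨j, hj⟩, Finset.mem_univ _, ?_⟩
  · rw [map_smul, map_smul, C.basis_apply, C.dual_apply ω i.2]
    exact mul_le_mul_of_nonneg_left (hle hB _) (hCy i).le
  · rw [map_smul, map_smul, C.basis_apply, C.dual_apply ω hj]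
    exact mul_lt_mul_of_pos_left (hB j hjB) (hCy _)

open Classical in
/-- A regular triangulation of a pointed cone covers every generic point exactly once. -/
theorem exists_triangulation (u : ι → V) (l : V →ₗ[ℝ] ℝ) (hl : ∀ i, l (u i) = 1) :
    ∃ T : Finset (Cell u), ∀ y, Generic u y →
      (if y ∈ posCone u then (1 : ℝ) else 0) =
        ∑ B ∈ T, if ∀ i, 0 < B.basis.coord i y then 1 else 0 := by
  obtain ⟨ω, hω⟩ := exists_nondegenerate u
  refine ⟨regularCells u ω, fun y hy => ?_⟩
  split_ifs with h
  · obtain ⟨B, hB, hBy⟩ := exists_regularCell hl hω hy h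
    rw [Finset.sum_eq_single B, if_pos hBy]
    · intro C hC hCB
      refine if_neg fun hCy => hCB (Subtype.ext ?_)
      exact (regularCell_unique hB hC hBy hCy).antisymm (regularCell_unique hC hB hCy hBy)
    · exact fun h => absurd hB h
  · refine (Finset.sum_eq_zero fun B _ => if_neg fun hB => h ?_).symm
    exact mem_posCone_of_coord_nonneg B fun i => (hB i).le

end Triangulation

end WeightedEhrhart

namespace WeightedEhrhart

open Filter Topology Module

/-! ### Half-open decompositions of the cone and of its interior. -/

section HalfOpen

lemma subsingleton_setOf_add_smul_mem {V : Type*} [AddCommGroup V] [Module ℝ V]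
    {E : Submodule ℝ V} {x η : V} (hη : η ∉ E) : {ε : ℝ | x + ε • η ∈ E}.Subsingleton := by
  intro a ha b hb
  by_contra hab
  have h : (a - b) • η ∈ E := by
    have := E.sub_mem ha hb
    rwa [add_sub_add_left_eq_sub, ← sub_smul] at this
  exact hη ((E.smul_mem_iff (sub_ne_zero.2 hab)).1 h)

lemma eventually_notMem_of_subsingleton {s : Set ℝ} (hs : s.Subsingleton) :
    ∀ᶠ ε in 𝓝[>] (0 : ℝ), ε ∉ s := by
  have h : (s \ {0})ᶜ ∈ 𝓝 (0 : ℝ) := by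
    refine (hs.finite.subset Set.sdiff_subset).isClosed.isOpen_compl.mem_nhds ?_
    simp
  filter_upwards [mem_nhdsWithin_of_mem_nhds h, self_mem_nhdsWithin] with ε hε hpos hmem
  exact hε ⟨hmem, ne_of_gt hpos⟩

/-- A set closed under addition and positive scaling which spans the whole space contains a vector
that avoids any given finite collection of proper subspaces. -/
lemma exists_mem_forall_notMem {V : Type*} [AddCommGroup V] [Module ℝ V] {C : Set V}
    (hC : C.Nonempty) (hadd : ∀ x ∈ C, ∀ y ∈ C, x + y ∈ C)
    (hsmul : ∀ x ∈ C, ∀ c : ℝ, 0 < c → c • x ∈ C) (hspan : Submodule.span ℝ C = ⊤)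
    {𝓔 : Set (Submodule ℝ V)} (hfin : 𝓔.Finite) (hne : ∀ E ∈ 𝓔, E ≠ ⊤) :
    ∃ ξ ∈ C, ∀ E ∈ 𝓔, ξ ∉ E := by
  induction 𝓔, hfin using Set.Finite.induction_on with
  | empty => exact ⟨hC.some, hC.some_mem, by simp⟩
  | @insert E 𝓕 _ hF ih =>
    obtain ⟨ξ, hξ, hξF⟩ := ih fun E hE => hne E (Set.mem_insert_of_mem _ hE)
    obtain ⟨c, hc, hcE⟩ : ∃ c ∈ C, c ∉ E := by
      by_contra! h
      exact hne E (Set.mem_insert _ _) (top_le_iff.1 (hspan ▸ Submodule.span_le.2 h))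
    -- The line through `ξ` in direction `c` meets each subspace at most once: `E` because `c ∉ E`,
    -- the others because they miss `ξ`.
    have h1 : ∀ᶠ ε in 𝓝[>] (0 : ℝ), ξ + ε • c ∉ E :=
      eventually_notMem_of_subsingleton (subsingleton_setOf_add_smul_mem hcE)
    have h2 : ∀ᶠ ε in 𝓝[>] (0 : ℝ), ∀ E' ∈ 𝓕, ξ + ε • c ∉ E' := by
      rw [eventually_all_finite hF]
      intro E' hE'
      refine eventually_notMem_of_subsingleton (s := {ε : ℝ | ξ + ε • c ∈ E'}) ?_
      intro a ha b hb
      by_contra hab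
      refine hξF E' hE' ?_
      have h : (a - b) • c ∈ E' := by
        have := E'.sub_mem ha hb
        rwa [add_sub_add_left_eq_sub, ← sub_smul] at this
      have hcE' := (E'.smul_mem_iff (sub_ne_zero.2 hab)).1 h
      exact (E'.add_mem_iff_left (E'.smul_mem a hcE')).1 ha
    obtain ⟨ε, ⟨hE, hF'⟩, hpos⟩ := ((h1.and h2).and self_mem_nhdsWithin).exists
    refine ⟨ξ + ε • c, hadd _ hξ _ (hsmul _ hc _ hpos), fun E' hE' => ?_⟩
    rcases Set.mem_insert_iff.1 hE' with rfl | h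
    exacts [hE, hF' E' h]

/-- Positivity of `a + ε b` for all sufficiently small `ε > 0`. -/
def LexPos (a b : ℝ) : Prop := 0 < a ∨ (a = 0 ∧ 0 < b)

lemma LexPos.nonneg {a b : ℝ} (h : LexPos a b) : 0 ≤ a := by
  rcases h with h | h
  exacts [h.le, h.1.ge]

/-- The nonzero `b` breaks the tie at `a = 0`. This makes the conditions for `ξ` at `x` and for `-ξ`
at `-x` complementary in each coordinate, the source of reciprocity. -/
lemma lexPos_neg_neg {a b : ℝ} (hb : b ≠ 0) : LexPos (-a) (-b) ↔ ¬ LexPos a b := by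
  unfold LexPos
  rcases lt_trichotomy a 0 with ha | ha | ha
  · simp [ha, ha.not_gt, ha.ne]
  · subst ha
    simp only [neg_zero, lt_irrefl, true_and, false_or, Left.neg_pos_iff, not_lt]
    exact ⟨le_of_lt, fun h => lt_of_le_of_ne h hb⟩
  · simp [ha, ha.not_gt, ha.ne']

lemma eventually_pos_iff_lexPos (a b : ℝ) : ∀ᶠ ε in 𝓝[>] (0 : ℝ), (0 < a + ε * b ↔ LexPos a b) := by
  have ht : Tendsto (fun ε => a + ε * b) (𝓝[>] 0) (𝓝 a) := by
    have : Tendsto (fun ε => a + ε * b) (𝓝[>] 0) (𝓝 (a + 0 * b)) :=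
      (Continuous.tendsto (by fun_prop) 0).mono_left nhdsWithin_le_nhds
    simpa using this
  rcases lt_trichotomy a 0 with ha | ha | ha
  · filter_upwards [ht.eventually (gt_mem_nhds ha)] with ε hε
    simp [LexPos, hε.not_gt, ha.not_gt, ha.ne]
  · filter_upwards [self_mem_nhdsWithin] with ε hε
    simp [LexPos, ha, mul_pos_iff_of_pos_left (show 0 < ε from hε)]
  · filter_upwards [ht.eventually (lt_mem_nhds ha)] with ε hε
    simp [LexPos, hε, ha]

variable {ι V : Type*} [Fintype ι] [NormedAddCommGroup V] [NormedSpace ℝ V] {u : ι → V}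

omit [Fintype ι] in
lemma Generic.neg {η : V} (hη : Generic u η) : Generic u (-η) := fun S hS h =>
  hη S hS (neg_mem_iff.1 h)

lemma Generic.eventually_add_smul {η : V} (hη : Generic u η) (x : V) :
    ∀ᶠ ε in 𝓝[>] (0 : ℝ), Generic u (x + ε • η) := by
  unfold Generic
  rw [eventually_all]
  intro S
  by_cases hS : Submodule.span ℝ (u '' S) = ⊤
  · simp [hS]
  · filter_upwards [eventually_notMem_of_subsingleton
      (subsingleton_setOf_add_smul_mem (x := x) (hη S hS))] with ε hε _
    exact hε

/-- The half-open simplicial cone of a cell, seen from the direction `η`. -/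
def Cell.HalfOpen (B : Cell u) (η x : V) : Prop :=
  ∀ i, LexPos (B.basis.coord i x) (B.basis.coord i η)

/-- The points of a cone that stay in the cone when they move a little against `ξ`. -/
def shiftedCone (u : ι → V) (ξ : V) : Set V := {x | ∃ ε : ℝ, 0 < ε ∧ x - ε • ξ ∈ posCone u}

-- For small ε the point `x + ε • η` is generic, and its coordinates are positive exactly when
-- `LexPos` holds, so counting open cells there is counting half-open cells at `x`.
open Classical in
lemma eventually_sum_halfOpen {T : Finset (Cell u)}
    (hT : ∀ y, Generic u y → (if y ∈ posCone u then (1 : ℝ) else 0) =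
        ∑ B ∈ T, if ∀ i, 0 < B.basis.coord i y then 1 else 0)
    {η : V} (hη : Generic u η) (x : V) :
    ∀ᶠ ε in 𝓝[>] (0 : ℝ), (if x + ε • η ∈ posCone u then (1 : ℝ) else 0) =
      ∑ B ∈ T, if B.HalfOpen η x then 1 else 0 := by
  have h : ∀ᶠ ε in 𝓝[>] (0 : ℝ), ∀ B : Cell u, ∀ i,
      (0 < B.basis.coord i x + ε * B.basis.coord i η ↔
        LexPos (B.basis.coord i x) (B.basis.coord i η)) := by
    simp only [eventually_all]
    exact fun B i => eventually_pos_iff_lexPos _ _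
  filter_upwards [h, hη.eventually_add_smul x] with ε hε hgen
  rw [hT _ hgen]
  refine Finset.sum_congr rfl fun B _ => ?_
  congr 1
  simp only [map_add, map_smul, smul_eq_mul, hε, Cell.HalfOpen]

open Classical in
lemma indicator_posCone_eq_sum {T : Finset (Cell u)}
    (hT : ∀ y, Generic u y → (if y ∈ posCone u then (1 : ℝ) else 0) =
        ∑ B ∈ T, if ∀ i, 0 < B.basis.coord i y then 1 else 0)
    {ξ : V} (hξ : Generic u ξ) (hξC : ξ ∈ posCone u) (x : V) :
    (if x ∈ posCone u then (1 : ℝ) else 0) = ∑ B ∈ T, if B.HalfOpen ξ x then 1 else 0 := by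
  obtain ⟨ε, hε, hpos⟩ :=
    ((eventually_sum_halfOpen hT hξ x).and self_mem_nhdsWithin).exists
  rw [← hε]
  by_cases hx : x ∈ posCone u
  · rw [if_pos hx, if_pos (posCone_add hx (posCone_smul hξC (le_of_lt hpos)))]
  · rw [if_neg hx, hε]
    refine (Finset.sum_eq_zero fun B _ => if_neg fun hB => hx ?_).symm
    exact mem_posCone_of_coord_nonneg B fun i => (hB i).nonneg

-- A generic `ξ` in the cone is an interior vector, so `shiftedCone u ξ` is the interior of the
-- cone.
open Classical in
lemma indicator_shiftedCone_eq_sum {T : Finset (Cell u)}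
    (hT : ∀ y, Generic u y → (if y ∈ posCone u then (1 : ℝ) else 0) =
        ∑ B ∈ T, if ∀ i, 0 < B.basis.coord i y then 1 else 0)
    {ξ : V} (hξ : Generic u ξ) (hξC : ξ ∈ posCone u) (x : V) :
    (if x ∈ shiftedCone u ξ then (1 : ℝ) else 0) =
      ∑ B ∈ T, if B.HalfOpen (-ξ) x then 1 else 0 := by
  have hev := (eventually_sum_halfOpen hT hξ.neg x).and self_mem_nhdsWithin
  by_cases hx : x ∈ shiftedCone u ξ
  · obtain ⟨δ, hδ, hxδ⟩ := hx
    obtain ⟨ε, ⟨hε, -⟩, hεδ⟩ := (hev.and (Ioo_mem_nhdsGT hδ)).exists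
    rw [← hε, if_pos ⟨δ, hδ, hxδ⟩, if_pos]
    -- Membership for one shift δ passes to every smaller shift, as `ξ` lies in the cone.
    have : x + ε • -ξ = (x - δ • ξ) + (δ - ε) • ξ := by module
    rw [this]
    exact posCone_add hxδ (posCone_smul hξC (sub_nonneg.2 hεδ.2.le))
  · obtain ⟨ε, hε, hpos⟩ := hev.exists
    rw [← hε, if_neg hx, if_neg]
    intro h
    exact hx ⟨ε, hpos, by rwa [smul_neg, ← sub_eq_add_neg] at h⟩

end HalfOpen

end WeightedEhrhart

namespace WeightedEhrhart

open Module

set_option linter.unusedSectionVars false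

/-! ### Difference operators, polynomial functions and level sums. -/

section Differences

variable {A : Type*} [AddCommGroup A]

/-- Translation of functions by a group element. -/
def translate (u : A) : Module.End ℝ (A → ℝ) := LinearMap.funLeft ℝ ℝ fun x => x - u

@[simp] lemma translate_apply (u : A) (f : A → ℝ) (x : A) : translate u f x = f (x - u) := rfl

/-- The backward difference operator. -/
def bdiff (u : A) : Module.End ℝ (A → ℝ) := 1 - translate u

@[simp] lemma bdiff_apply (u : A) (f : A → ℝ) (x : A) : bdiff u f x = f x - f (x - u) := rfl

lemma commute_bdiff_translate (u v : A) : Commute (bdiff u) (translate v) := by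
  refine Commute.sub_left (Commute.one_left _) ?_
  refine LinearMap.ext fun f => funext fun x => ?_
  change f (x - u - v) = f (x - v - u)
  rw [sub_right_comm]

/-- Polynomial functions of degree less than `n`, characterized by their differences. -/
def DegLT : ℕ → (A → ℝ) → Prop
  | 0, w => w = 0
  | n + 1, w => ∀ u : A, DegLT n fun x => w (x + u) - w x

lemma DegLT.add {n : ℕ} {f g : A → ℝ} (hf : DegLT n f) (hg : DegLT n g) :
    DegLT n fun x => f x + g x := by
  induction n generalizing f g with
  | zero =>
    rw [DegLT] at *
    subst hf hg
    ext
    simp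
  | succ n ih =>
    intro u
    have := ih (hf u) (hg u)
    convert this using 2
    ring

lemma DegLT.const_mul {n : ℕ} {f : A → ℝ} (hf : DegLT n f) (c : ℝ) :
    DegLT n fun x => c * f x := by
  induction n generalizing f with
  | zero =>
    rw [DegLT] at *
    subst hf
    ext
    simp
  | succ n ih =>
    intro u
    have := ih (hf u)
    convert this using 2
    ring

lemma DegLT.comp_add {n : ℕ} {f : A → ℝ} (hf : DegLT n f) (v : A) :
    DegLT n fun x => f (x + v) := by
  induction n generalizing f with
  | zero =>
    rw [DegLT] at *
    subst hf
    rfl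
  | succ n ih =>
    intro u
    have := ih (hf u)
    convert this using 2 with x
    rw [add_right_comm]

lemma DegLT.succ {n : ℕ} {f : A → ℝ} (hf : DegLT n f) : DegLT (n + 1) f := by
  induction n generalizing f with
  | zero =>
    rw [DegLT] at hf
    subst hf
    intro u
    rw [DegLT]
    ext
    simp
  | succ n ih => exact fun u => ih (hf u)

lemma DegLT.mono {m n : ℕ} (h : m ≤ n) {f : A → ℝ} (hf : DegLT m f) : DegLT n f := by
  induction h with
  | refl => exact hf
  | step _ ih => exact ih.succ

lemma degLT_const (c : ℝ) : DegLT 1 fun _ : A => c := fun u => by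
  rw [DegLT]
  ext
  simp

lemma DegLT.mul_hom {n : ℕ} {f : A → ℝ} (hf : DegLT n f) (l : A →+ ℝ) :
    DegLT (n + 1) fun x => l x * f x := by
  induction n generalizing f with
  | zero =>
    rw [DegLT] at hf
    subst hf
    intro u
    rw [DegLT]
    ext
    simp
  | succ n ih =>
    intro u
    have h1 : DegLT (n + 1) fun x => l u * f (x + u) := (hf.comp_add u).const_mul _
    have h2 : DegLT (n + 1) fun x => l x * (f (x + u) - f x) := ih (hf u)
    convert h1.add h2 using 2
    simp only [map_add]
    ring

variable {G : Type*} [AddCommGroup G] (ht : G →+ ℤ)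

/-- Finiteness of the support on each level of the height function. -/
def FiberFinite (f : G → ℝ) : Prop := ∀ k, ({x | ht x = k} ∩ Function.support f).Finite

/-- The sums of a function over the levels of the height function. -/
noncomputable def fiberSum (f : G → ℝ) : ℤ → ℝ := fun k => ∑ᶠ x ∈ {x | ht x = k}, f x

variable {ht}

lemma FiberFinite.mono {f g : G → ℝ} (hf : FiberFinite ht f) (h : ∀ x, f x = 0 → g x = 0) :
    FiberFinite ht g := fun k => (hf k).subset fun x hx => ⟨hx.1, fun h0 => hx.2 (h x h0)⟩

lemma FiberFinite.add {f g : G → ℝ} (hf : FiberFinite ht f) (hg : FiberFinite ht g) :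
    FiberFinite ht (f + g) := fun k => ((hf k).union (hg k)).subset fun x hx => by
  rw [← Set.inter_union_distrib_left]
  exact ⟨hx.1, Function.support_add _ _ hx.2⟩

lemma FiberFinite.translate {f : G → ℝ} (hf : FiberFinite ht f) (u : G) :
    FiberFinite ht (translate u f) := fun k => by
  refine ((hf (k - ht u)).image (· + u)).subset ?_
  rintro x ⟨hx, hfx⟩
  exact ⟨x - u, ⟨by simp_all, hfx⟩, by simp⟩

lemma FiberFinite.neg {f : G → ℝ} (hf : FiberFinite ht f) (c : ℝ) :
    FiberFinite ht fun x => c * f (-x) := fun k => by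
  refine ((hf (-k)).image Neg.neg).subset ?_
  rintro x ⟨hx, hfx⟩
  exact ⟨-x, ⟨by simp_all, right_ne_zero_of_mul hfx⟩, by simp⟩

lemma fiberSum_add {f g : G → ℝ} (hf : FiberFinite ht f) (hg : FiberFinite ht g) :
    fiberSum ht (f + g) = fiberSum ht f + fiberSum ht g :=
  funext fun k => finsum_mem_add_distrib' (hf k) (hg k)

lemma fiberSum_zero : fiberSum ht 0 = 0 := funext fun k => by simp [fiberSum]

lemma fiberSum_const_mul (c : ℝ) (f : G → ℝ) (k : ℤ) :
    fiberSum ht (fun x => c * f x) k = c * fiberSum ht f k := by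
  simp only [fiberSum, ← smul_eq_mul, smul_finsum]

lemma fiberSum_translate (f : G → ℝ) (u : G) :
    fiberSum ht (translate u f) = translate (ht u) (fiberSum ht f) := funext fun k => by
  refine finsum_mem_eq_of_bijOn (fun x => x - u) ⟨fun x hx => ?_, ?_, fun x hx => ?_⟩ fun _ _ => rfl
  · simp_all
  · exact (sub_left_injective).injOn
  · exact ⟨x + u, by simp_all, by simp⟩

lemma fiberSum_comp_neg (f : G → ℝ) (k : ℤ) :
    fiberSum ht (fun x => f (-x)) k = fiberSum ht f (-k) := by
  refine finsum_mem_eq_of_bijOn (fun x => -x) ⟨fun x hx => ?_, ?_, fun x hx => ?_⟩ fun _ _ => rfl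
  · simp_all
  · exact neg_injective.injOn
  · exact ⟨-x, by simp_all, by simp⟩

lemma fiberSum_finsetSum {κ : Type*} (s : Finset κ) (f : κ → G → ℝ)
    (hf : ∀ i ∈ s, FiberFinite ht (f i)) :
    FiberFinite ht (∑ i ∈ s, f i) ∧ fiberSum ht (∑ i ∈ s, f i) = ∑ i ∈ s, fiberSum ht (f i) := by
  classical
  induction s using Finset.induction_on with
  | empty => exact ⟨fun k => by simp, by simp [fiberSum_zero]⟩
  | insert i s hi ih =>
    have h1 := hf i (Finset.mem_insert_self _ _)
    obtain ⟨h2, h3⟩ := ih fun j hj => hf j (Finset.mem_insert_of_mem hj)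
    rw [Finset.sum_insert hi, Finset.sum_insert hi, fiberSum_add h1 h2, h3]
    exact ⟨h1.add h2, rfl⟩

/-- If `r` backward differences of step height `q` annihilate `φ` and `w` is a polynomial function
of degree at most `m`, then the level sums of `w φ` are annihilated by `r + m` differences. -/
theorem bdiff_pow_fiberSum_eq_zero {q : ℤ} (L : List G) (hL : ∀ u ∈ L, ht u = q) (m : ℕ)
    {w φ : G → ℝ} (hw : DegLT (m + 1) w) (hφ : FiberFinite ht φ)
    (hkill : L.foldl (fun f u => bdiff u f) φ = 0) :
    (bdiff q ^ (L.length + m)) (fiberSum ht (w * φ)) = 0 := by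
  induction L generalizing m w φ with
  | nil =>
    rw [List.foldl_nil] at hkill
    rw [hkill, mul_zero, fiberSum_zero, map_zero]
  | cons u L ih =>
    induction m using Nat.strong_induction_on generalizing w φ with | _ m ihm => ?_
    have hu : ht u = q := hL u List.mem_cons_self
    have hL' : ∀ v ∈ L, ht v = q := fun v hv => hL v (List.mem_cons_of_mem _ hv)
    rw [List.foldl_cons] at hkill
    have hbφ : FiberFinite ht (bdiff u φ) := by
      have : bdiff u φ = φ + (fun x => (-1) * translate u φ x) := by
        ext x
        simp [sub_eq_add_neg]
      rw [this]
      exact hφ.add ((hφ.translate u).mono fun x hx => by rw [hx, mul_zero])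
    set dw : G → ℝ := fun x => w (x + u) - w x with hdw
    -- Leibniz rule: in the first term one generator has been used up, in the second the weight has
    -- lost a degree; the third becomes the translate that turns the level sum into a difference.
    have hprod : w * φ = w * bdiff u φ + translate u (dw * φ) + translate u (w * φ) := by
      ext x
      simp [hdw]
      ring
    have hwφ : FiberFinite ht (w * φ) := hφ.mono fun x hx => by simp [hx]
    have hdwφ : FiberFinite ht (dw * φ) := hφ.mono fun x hx => by simp [hx]
    have hwbφ : FiberFinite ht (w * bdiff u φ) := hbφ.mono fun x hx => by
      rw [Pi.mul_apply, hx, mul_zero]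
    have hstep : bdiff q (fiberSum ht (w * φ)) =
        fiberSum ht (w * bdiff u φ) + translate q (fiberSum ht (dw * φ)) := by
      have h := fiberSum_add (hwbφ.add (hdwφ.translate u)) (hwφ.translate u)
      rw [← hprod, fiberSum_add hwbφ (hdwφ.translate u), fiberSum_translate, fiberSum_translate,
        hu] at h
      change fiberSum ht (w * φ) - translate q (fiberSum ht (w * φ)) = _
      rw [sub_eq_iff_eq_add]
      exact h
    have h1 := ih hL' m hw hbφ hkill
    have h2 : (bdiff q ^ (L.length + m)) (fiberSum ht (dw * φ)) = 0 := by
      cases m with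
      | zero =>
        have : dw = 0 := hw u
        rw [this, zero_mul, fiberSum_zero, map_zero]
      | succ m =>
        have := ihm m m.lt_succ_self (hw u) hφ (by rwa [List.foldl_cons])
        rwa [List.length_cons, add_right_comm] at this
    rw [show (u :: L).length + m = (L.length + m) + 1 by simp; ring, pow_succ,
      Module.End.mul_apply, hstep, map_add, h1, zero_add]
    have hc := ((commute_bdiff_translate q q).pow_left (L.length + m)).eq
    rw [← Module.End.mul_apply, hc, Module.End.mul_apply, h2, map_zero]

lemma foldl_bdiff_sub {κ : Type*} (v : κ → A) (L : List κ) (f g : A → ℝ) :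
    L.foldl (fun f j => bdiff (v j) f) (f - g) =
      L.foldl (fun f j => bdiff (v j) f) f - L.foldl (fun f j => bdiff (v j) f) g := by
  induction L generalizing f g with
  | nil => rfl
  | cons j L ih => rw [List.foldl_cons, List.foldl_cons, List.foldl_cons, map_sub, ih]

/-- The difference along `v j` acts on the factor `α j` alone, since the other factors are invariant
under that translation. -/
lemma foldl_bdiff_prod {κ : Type*} [Fintype κ] [DecidableEq κ] (v : κ → A) (L : List κ)
    (hL : L.Nodup) (α : κ → A → ℝ) (hα : ∀ i j, i ≠ j → ∀ x, α i (x - v j) = α i x) :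
    L.foldl (fun f j => bdiff (v j) f) (fun x => ∏ i, α i x) =
      fun x => ∏ i, if i ∈ L then bdiff (v i) (α i) x else α i x := by
  induction L generalizing α with
  | nil => simp
  | cons j L ih =>
    obtain ⟨hj, hL'⟩ := List.nodup_cons.1 hL
    have hstep : bdiff (v j) (fun x => ∏ i, α i x) =
        fun x => ∏ i, Function.update α j (bdiff (v j) (α j)) i x := by
      ext x
      rw [bdiff_apply, ← Finset.mul_prod_erase _ _ (Finset.mem_univ j),
        ← Finset.mul_prod_erase _ _ (Finset.mem_univ j),
        ← Finset.mul_prod_erase _ _ (Finset.mem_univ j)]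
      have h1 : ∏ i ∈ Finset.univ.erase j, α i (x - v j) = ∏ i ∈ Finset.univ.erase j, α i x :=
        Finset.prod_congr rfl fun i hi => hα i j (Finset.ne_of_mem_erase hi) x
      have h2 : ∏ i ∈ Finset.univ.erase j, Function.update α j (bdiff (v j) (α j)) i x =
          ∏ i ∈ Finset.univ.erase j, α i x :=
        Finset.prod_congr rfl fun i hi => by
          rw [Function.update_of_ne (Finset.ne_of_mem_erase hi)]
      rw [h1, h2, Function.update_self, bdiff_apply, sub_mul]
    rw [List.foldl_cons, hstep, ih hL']
    · ext x
      refine Finset.prod_congr rfl fun i _ => ?_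
      by_cases hij : i = j
      · subst hij
        simp [hj]
      · simp [hij]
    · intro i k hik x
      by_cases hij : i = j
      · subst hij
        simp only [Function.update_self, bdiff_apply]
        rw [hα i k hik, sub_right_comm, hα i k hik]
      · simp only [Function.update_of_ne hij]
        exact hα i k hik x

end Differences

/-! ### Weighted reciprocity, cell by cell. -/

section Reciprocity

variable {ι V G : Type*} [Fintype ι] [NormedAddCommGroup V] [NormedSpace ℝ V] {u : ι → V}
  [AddCommGroup G] {ht : G →+ ℤ} {e : G →+ V} {g : ι → G} {q : ℤ}

open Classical in
/-- The local contribution of a cell to the reciprocity law. -/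
noncomputable def Cell.recipFun (B : Cell u) (e : G →+ V) (ξ : V) (x : G) : ℝ :=
  (if B.HalfOpen ξ (e x) then 1 else 0) -
    (-1) ^ B.1.card * (if B.HalfOpen (-ξ) (e (-x)) then 1 else 0)

lemma Cell.HalfOpen.mem_posCone {B : Cell u} {η x : V} (h : B.HalfOpen η x) : x ∈ posCone u :=
  mem_posCone_of_coord_nonneg B fun i => (h i).nonneg

/-- By the dichotomy `lexPos_neg_neg`, the function is ∏ α i - ∏ (α i - 1) for step functions `α i`
of single coordinates. After one difference in each coordinate the two products agree, because `α i`
and `α i - 1` differ by a constant. -/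
lemma Cell.foldl_recipFun (B : Cell u) {ξ : V} (hξ : Generic u ξ)
    (hg : ∀ i, e (g i) = (q : ℝ) • u i) :
    List.foldl (fun f (i : B.1) => bdiff (g i) f) (B.recipFun e ξ) Finset.univ.toList = 0 := by
  classical
  set α : B.1 → G → ℝ := fun i x =>
    if LexPos (B.basis.coord i (e x)) (B.basis.coord i ξ) then 1 else 0 with hα
  have hinv : ∀ i j : B.1, i ≠ j → ∀ x, α i (x - g j) = α i x := by
    intro i j hij x
    have : B.basis.coord i (e (x - g j)) = B.basis.coord i (e x) := by
      rw [map_sub, hg, map_sub, map_smul, ← B.basis_apply j, Basis.coord_apply, Basis.coord_apply,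
        Basis.repr_self, Finsupp.single_eq_of_ne hij, smul_zero, sub_zero]
    simp only [hα, this]
  have heq : B.recipFun e ξ = (fun x => ∏ i, α i x) - fun x => ∏ i, (α i x - 1) := by
    ext x
    have h1 : ∏ i, α i x = if B.HalfOpen ξ (e x) then 1 else 0 := by
      simp [hα, Cell.HalfOpen, Finset.prod_ite_zero]
    have h2 : ∏ i, (α i x - 1) =
        (-1) ^ B.1.card * (if B.HalfOpen (-ξ) (e (-x)) then 1 else 0) := by
      have h3 : ∀ i, α i x - 1 = (-1) *
          (if LexPos (B.basis.coord i (e (-x))) (B.basis.coord i (-ξ)) then 1 else 0) := by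
        intro i
        simp only [hα, map_neg, lexPos_neg_neg (hξ.coord_ne_zero B i)]
        split_ifs <;> simp_all
      simp only [h3, Finset.prod_mul_distrib, Finset.prod_const, Finset.card_univ,
        Fintype.card_coe]
      simp [Cell.HalfOpen, Finset.prod_ite_zero]
    simp only [Cell.recipFun, Pi.sub_apply, h1, h2]
  have hinv' : ∀ i j : B.1, i ≠ j → ∀ x, α i (x - g j) - 1 = α i x - 1 := fun i j hij x => by
    rw [hinv i j hij]
  rw [heq, foldl_bdiff_sub (fun i : B.1 => g i),
    foldl_bdiff_prod (fun i : B.1 => g i) _ (Finset.nodup_toList _) α hinv,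
    foldl_bdiff_prod (fun i : B.1 => g i) _ (Finset.nodup_toList _) (fun i x => α i x - 1) hinv']
  simp

lemma Cell.card_eq_finrank (B : Cell u) : B.1.card = finrank ℝ V := by
  rw [finrank_eq_card_basis B.basis, Fintype.card_coe]

open Classical in
/-- **Weighted Ehrhart reciprocity** for the cone generated by finitely many lattice vectors of the
same height: the level sums over the cone, continued to negative levels by those over the shifted
cone, are annihilated by a power of the difference operator. -/
theorem weighted_reciprocity (l : V →ₗ[ℝ] ℝ) (hl : ∀ i, l (u i) = 1)
    (hg : ∀ i, e (g i) = (q : ℝ) • u i) (hgh : ∀ i, ht (g i) = q)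
    (hfin : ∀ k, {x : G | ht x = k ∧ e x ∈ posCone u}.Finite)
    {ξ : V} (hξ : Generic u ξ) (hξC : ξ ∈ posCone u)
    {m : ℕ} {w : G → ℝ} (hw : DegLT (m + 1) w) (hwneg : ∀ x, w (-x) = (-1) ^ m * w x) :
    (bdiff q ^ (finrank ℝ V + m))
      (fun k => fiberSum ht (fun x => w x * if e x ∈ posCone u then 1 else 0) k -
        (-1) ^ (finrank ℝ V + m) *
          fiberSum ht (fun x => w x * if e x ∈ shiftedCone u ξ then 1 else 0) (-k)) = 0 := by
  obtain ⟨T, hT⟩ := exists_triangulation u l hl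
  have hcone : FiberFinite ht fun x => if e x ∈ posCone u then (1 : ℝ) else 0 := fun k =>
    (hfin k).subset fun x ⟨hx, hx'⟩ => ⟨hx, by simpa using hx'⟩
  have hhalf : ∀ (B : Cell u) (η : V),
      FiberFinite ht fun x => if B.HalfOpen η (e x) then (1 : ℝ) else 0 := fun B η =>
    hcone.mono fun x hx => by
      have : e x ∉ posCone u := by simpa using hx
      exact if_neg fun h => this h.mem_posCone
  have hrec : ∀ B : Cell u, FiberFinite ht (B.recipFun e ξ) := fun B => by
    have h := (hhalf B ξ).add ((hhalf B (-ξ)).neg (-(-1) ^ B.1.card))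
    refine h.mono fun x hx => ?_
    rw [Cell.recipFun, sub_eq_add_neg, ← neg_mul]
    exact hx
  have hwrec : ∀ B : Cell u, FiberFinite ht (w * B.recipFun e ξ) := fun B =>
    (hrec B).mono fun x hx => by rw [Pi.mul_apply, hx, mul_zero]
  have hsum : (fun k => fiberSum ht (fun x => w x * if e x ∈ posCone u then 1 else 0) k -
        (-1) ^ (finrank ℝ V + m) *
          fiberSum ht (fun x => w x * if e x ∈ shiftedCone u ξ then 1 else 0) (-k)) =
      ∑ B ∈ T, fiberSum ht (w * B.recipFun e ξ) := by
    rw [← (fiberSum_finsetSum T _ fun B _ => hwrec B).2]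
    ext k
    set f1 : G → ℝ := fun x => w x * if e x ∈ posCone u then 1 else 0 with hf1
    set f2 : G → ℝ := fun x => w x * if e x ∈ shiftedCone u ξ then 1 else 0 with hf2
    have hsub : ∀ x, f1 x = 0 → f2 x = 0 := by
      intro x hx
      simp only [hf1, hf2] at hx ⊢
      by_cases h : e x ∈ shiftedCone u ξ
      · have hpos : e x ∈ posCone u := by
          obtain ⟨ε, hε, hx'⟩ := h
          simpa using posCone_add hx' (posCone_smul hξC hε.le)
        rw [if_pos hpos, mul_one] at hx
        rw [hx, zero_mul]
      · rw [if_neg h, mul_zero]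
    have hF1 : FiberFinite ht f1 := hcone.mono fun x hx => by
      simp only [hf1, hx, mul_zero]
    have hF2 := (hF1.mono hsub).neg (-(-1) ^ (finrank ℝ V + m))
    have h := congrFun (fiberSum_add hF1 hF2) k
    rw [Pi.add_apply, fiberSum_const_mul, fiberSum_comp_neg, neg_mul, ← sub_eq_add_neg] at h
    rw [← h]
    congr 1
    ext x
    simp only [hf1, hf2, Pi.add_apply, Finset.sum_apply, Pi.mul_apply, Cell.recipFun, hwneg,
      indicator_posCone_eq_sum hT hξ hξC, indicator_shiftedCone_eq_sum hT hξ hξC,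
      Cell.card_eq_finrank, ← Finset.mul_sum, Finset.sum_sub_distrib]
    -- The parity sign of `w` under reflection cancels the `(-1) ^ m` of the statement; the sign of
    -- the dimension comes from the cells.
    have hsq : ((-1 : ℝ) ^ m) * (-1) ^ m = 1 := by rw [← mul_pow]; simp
    rw [pow_add]
    linear_combination (-(-1) ^ finrank ℝ V * w x *
      ∑ B ∈ T, if B.HalfOpen (-ξ) (e (-x)) then 1 else 0) * hsq
  rw [hsum, map_sum]
  refine Finset.sum_eq_zero fun B _ => ?_
  have hkill := B.foldl_recipFun hξ hg
  have h := bdiff_pow_fiberSum_eq_zero (q := q) (List.map (fun i : B.1 => g i) Finset.univ.toList)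
    (by simp [hgh]) m hw (hrec B) (by rwa [List.foldl_map])
  simpa [Cell.card_eq_finrank] using h

end Reciprocity

end WeightedEhrhart

namespace WeightedEhrhart

open Polynomial

/-! ### From annihilated sequences to polynomial numerators. -/

section Bridge

/-- The power series with the values of a function at the natural numbers as coefficients. -/
noncomputable def toSeries (F : ℤ → ℝ) : PowerSeries ℝ := PowerSeries.mk fun n => F n

lemma bdiff_pow_eq_zero_of_lt {q : ℕ} {F : ℤ → ℝ} {c : ℤ} (hF : ∀ k < c, F k = 0) (N : ℕ) :
    ∀ k < c, (bdiff (q : ℤ) ^ N) F k = 0 := by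
  induction N with
  | zero => exact hF
  | succ N ih =>
    intro k hk
    rw [pow_succ', Module.End.mul_apply, bdiff_apply, ih k hk, ih (k - q) (by omega), sub_zero]

lemma toSeries_bdiff_pow {q : ℕ} {F : ℤ → ℝ} (hF : ∀ k < 0, F k = 0) (N : ℕ) :
    toSeries ((bdiff (q : ℤ) ^ N) F) = (1 - PowerSeries.X ^ q) ^ N * toSeries F := by
  induction N with
  | zero => simp
  | succ N ih =>
    rw [pow_succ' (1 - PowerSeries.X ^ q : PowerSeries ℝ), mul_assoc, ← ih, pow_succ',
      Module.End.mul_apply]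
    ext n
    rw [sub_mul, one_mul, map_sub, PowerSeries.coeff_X_pow_mul']
    simp only [toSeries, PowerSeries.coeff_mk, bdiff_apply]
    split_ifs with h
    · rw [Nat.cast_sub h]
    · rw [bdiff_pow_eq_zero_of_lt hF N ((n : ℤ) - q) (by omega)]

/-- Under reflection each backward difference becomes a forward one: a sign and a shift by `q`. -/
lemma bdiff_pow_comp_sub {q : ℤ} (F : ℤ → ℝ) (N : ℕ) (k : ℤ) :
    (bdiff q ^ N) (fun k => F (-k)) k = (-1) ^ N * (bdiff q ^ N) F (q * N - k) := by
  induction N generalizing k with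
  | zero => simp
  | succ N ih =>
    simp only [pow_succ', Module.End.mul_apply, bdiff_apply, ih]
    push_cast
    rw [show q * N - (k - q) = q * (N + 1) - k by ring,
      show q * (N + 1) - k - q = q * N - k by ring]
    ring

/-- A two-sided reciprocity law turns the series into rational functions whose numerator is a
polynomial, with the reflected polynomial as the numerator of the dual series. -/
theorem numerator_of_reciprocity {q N : ℕ} {F F' : ℤ → ℝ} (hF : ∀ k < 0, F k = 0)
    (hF' : ∀ k < 1, F' k = 0)
    (h : (bdiff (q : ℤ) ^ N) (fun k => F k - (-1) ^ N * F' (-k)) = 0) :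
    (PowerSeries.trunc (q * N) ((1 - PowerSeries.X ^ q) ^ N * toSeries F) : PowerSeries ℝ) =
        (1 - PowerSeries.X ^ q) ^ N * toSeries F ∧
      (reflect (q * N) (PowerSeries.trunc (q * N) ((1 - PowerSeries.X ^ q) ^ N * toSeries F)) :
        PowerSeries ℝ) = (1 - PowerSeries.X ^ q) ^ N * toSeries F' := by
  -- The left side vanishes for k < 0 and the right side for k ≥ qN. Hence the numerator has degree
  -- below qN, and the substitution k ↦ qN - k reverses its coefficients.
  have key : ∀ k, (bdiff (q : ℤ) ^ N) F k = (bdiff (q : ℤ) ^ N) F' (q * N - k) := by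
    intro k
    have h1 : (fun k => F k - (-1) ^ N * F' (-k)) = F - ((-1) ^ N : ℝ) • fun k => F' (-k) := by
      ext
      simp
    have h2 := congrFun h k
    rw [h1, map_sub, map_smul, Pi.sub_apply, Pi.smul_apply, bdiff_pow_comp_sub, smul_eq_mul,
      ← mul_assoc, ← mul_pow, Pi.zero_apply] at h2
    simpa [sub_eq_zero] using h2
  rw [← toSeries_bdiff_pow hF, ← toSeries_bdiff_pow fun k hk => hF' k (by omega)]
  constructor
  · ext n
    rw [Polynomial.coeff_coe, PowerSeries.coeff_trunc]
    split_ifs with hn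
    · rfl
    · rw [toSeries, PowerSeries.coeff_mk, key, bdiff_pow_eq_zero_of_lt hF' N]
      push_cast [not_lt] at hn
      have : (q : ℤ) * N ≤ n := by exact_mod_cast hn
      omega
  · ext n
    rw [Polynomial.coeff_coe, coeff_reflect, PowerSeries.coeff_trunc]
    simp only [toSeries, PowerSeries.coeff_mk]
    rcases le_or_gt n (q * N) with hn | hn
    · rw [revAt_le hn]
      have hc : (((q * N - n : ℕ) : ℕ) : ℤ) = q * N - n := by
        rw [Nat.cast_sub hn]
        push_cast
        rfl
      split_ifs with h0
      · rw [key, hc, sub_sub_cancel]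
      -- The reversed coefficient at 0 was truncated away; it must be zero, and is, because `F'`
      -- starts at level 1.
      · have : n = 0 := by omega
        rw [this, bdiff_pow_eq_zero_of_lt hF' N _ (by simp)]
    · rw [revAt_eq_self_of_lt hn, if_neg hn.not_gt]
      have h1 := key (q * N - n)
      rw [sub_sub_cancel] at h1
      rw [← h1, bdiff_pow_eq_zero_of_lt hF N]
      have : (q : ℤ) * N < n := by exact_mod_cast hn
      omega

end Bridge

/-! ### Comparing numerators on [0, 1] and, by reversal, beyond 1. -/

section Evaluation

/-- Absolute convergence of a power series at a real number. -/
def AbsConv (s : ℝ) (φ : PowerSeries ℝ) : Prop :=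
  Summable fun n => ‖PowerSeries.coeff n φ * s ^ n‖

/-- The sum of a power series at a real number. -/
noncomputable def evalAt (s : ℝ) (φ : PowerSeries ℝ) : ℝ := ∑' n, PowerSeries.coeff n φ * s ^ n

lemma coeff_mul_mul_pow (s : ℝ) (φ ψ : PowerSeries ℝ) (n : ℕ) :
    PowerSeries.coeff n (φ * ψ) * s ^ n = ∑ kl ∈ Finset.HasAntidiagonal.antidiagonal n,
      (PowerSeries.coeff kl.1 φ * s ^ kl.1) * (PowerSeries.coeff kl.2 ψ * s ^ kl.2) := by
  rw [PowerSeries.coeff_mul, Finset.sum_mul]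
  refine Finset.sum_congr rfl fun kl hkl => ?_
  rw [← Finset.HasAntidiagonal.mem_antidiagonal.1 hkl, pow_add]
  ring

lemma AbsConv.mul {s : ℝ} {φ ψ : PowerSeries ℝ} (hφ : AbsConv s φ) (hψ : AbsConv s ψ) :
    AbsConv s (φ * ψ) := by
  have h := summable_norm_sum_mul_antidiagonal_of_summable_norm hφ hψ
  simpa only [AbsConv, coeff_mul_mul_pow] using h

lemma evalAt_mul {s : ℝ} {φ ψ : PowerSeries ℝ} (hφ : AbsConv s φ) (hψ : AbsConv s ψ) :
    evalAt s (φ * ψ) = evalAt s φ * evalAt s ψ := by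
  have h := tsum_mul_tsum_eq_tsum_sum_antidiagonal_of_summable_norm hφ hψ
  simp only [evalAt, coeff_mul_mul_pow]
  exact h.symm

lemma absConv_coe (s : ℝ) (p : ℝ[X]) : AbsConv s p := by
  refine summable_of_ne_finset_zero (s := p.support) fun n hn => ?_
  simp [notMem_support_iff.1 hn]

lemma evalAt_coe (s : ℝ) (p : ℝ[X]) : evalAt s p = p.eval s := by
  rw [evalAt, tsum_eq_sum (s := p.support), eval_eq_sum, Polynomial.sum]
  · simp
  · intro n hn
    simp [notMem_support_iff.1 hn]

lemma AbsConv.pow {s : ℝ} {φ : PowerSeries ℝ} (hφ : AbsConv s φ) (N : ℕ) : AbsConv s (φ ^ N) := by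
  induction N with
  | zero => simpa using absConv_coe s 1
  | succ N ih => exact pow_succ φ N ▸ ih.mul hφ

lemma exists_absConv_inverse {g : ℕ} (hg : 0 < g) {s : ℝ} (hs0 : 0 ≤ s) (hs1 : s < 1) :
    ∃ U : PowerSeries ℝ, U * (1 - PowerSeries.X ^ g) = 1 ∧ AbsConv s U := by
  refine ⟨PowerSeries.mk fun n => if g ∣ n then 1 else 0, ?_, ?_⟩
  · ext n
    rw [mul_sub, mul_one, map_sub, PowerSeries.coeff_mul_X_pow']
    simp only [PowerSeries.coeff_mk, PowerSeries.coeff_one]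
    rcases Nat.eq_zero_or_pos n with rfl | hn
    · simp [hg.ne']
    · by_cases hgn : g ≤ n
      · have h : g ∣ n - g ↔ g ∣ n := by
          rw [← Nat.dvd_add_self_right, Nat.sub_add_cancel hgn]
        simp [hgn, hn.ne', h]
      · have h : ¬ g ∣ n := fun h => hgn (Nat.le_of_dvd hn h)
        simp [hgn, hn.ne', h]
  · refine Summable.of_nonneg_of_le (fun _ => norm_nonneg _) (fun n => ?_)
      (summable_geometric_of_lt_one hs0 hs1)
    rw [PowerSeries.coeff_mk]
    split_ifs
    · simp [abs_of_nonneg hs0]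
    · simp [pow_nonneg hs0]

/-- A polynomial numerator of a series with nonnegative coefficients is nonnegative on `[0, 1]`. -/
theorem eval_nonneg_of_numerator {g : ℕ} (hg : 0 < g) {N : ℕ} {H : ℝ[X]} {E : PowerSeries ℝ}
    (hH : (H : PowerSeries ℝ) = (1 - PowerSeries.X ^ g) ^ N * E)
    (hE : ∀ n, 0 ≤ PowerSeries.coeff n E) {s : ℝ} (hs0 : 0 ≤ s) (hs1 : s ≤ 1) : 0 ≤ H.eval s := by
  have hlt : Set.Ico (0 : ℝ) 1 ⊆ {s | 0 ≤ H.eval s} := by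
    rintro s ⟨hs0, hs1⟩
    obtain ⟨U, hU, hUc⟩ := exists_absConv_inverse hg hs0 hs1
    -- Convergence of `E` below 1 is not assumed: it follows from E = H / (1 - X^g)^N.
    have hEeq : E = U ^ N * H := by
      rw [hH, ← mul_assoc, ← mul_pow, hU, one_pow, one_mul]
    have hEc : AbsConv s E := hEeq ▸ (hUc.pow N).mul (absConv_coe s H)
    have hcoe : ((1 - PowerSeries.X ^ g) ^ N : PowerSeries ℝ) = (((1 - X ^ g) ^ N : ℝ[X]) :
        PowerSeries ℝ) := by
      push_cast
      rfl
    rw [Set.mem_ofPred_eq, ← evalAt_coe, hH, hcoe, evalAt_mul (absConv_coe _ _) hEc, evalAt_coe]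
    refine mul_nonneg ?_ (tsum_nonneg fun n => mul_nonneg (hE n) (pow_nonneg hs0 n))
    simp only [eval_pow, eval_sub, eval_one, eval_X]
    exact pow_nonneg (sub_nonneg.2 (pow_le_one₀ hs0 hs1.le)) N
  have hcl : IsClosed {s | 0 ≤ H.eval s} := isClosed_le continuous_const H.continuous
  have := closure_minimal hlt hcl
  rw [closure_Ico zero_ne_one] at this
  exact this ⟨hs0, hs1⟩

/-- The polynomial `1 + X ^ a + ⋯ + X ^ (g - a)`. -/
noncomputable def geomPoly (a g : ℕ) : ℝ[X] := ∑ j ∈ Finset.range (g / a), X ^ (a * j)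

lemma eval_geomPoly (a g : ℕ) (t : ℝ) : (geomPoly a g).eval t = geomFactor a g t := by
  simp [geomPoly, geomFactor, eval_finsetSum]

lemma geomPoly_mul {a g : ℕ} (h : a ∣ g) : geomPoly a g * (1 - X ^ a) = 1 - X ^ g := by
  have := geom_sum_mul_neg (X ^ a : ℝ[X]) (g / a)
  simp only [← pow_mul, Nat.mul_div_cancel' h] at this
  exact this

/-- The sum is palindromic of degree g - a. -/
lemma geomFactor_inv {a g : ℕ} (h : a ∣ g) {t : ℝ} (ht : t ≠ 0) :
    geomFactor a g t * t ^ a = t ^ g * geomFactor a g t⁻¹ := by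
  obtain ⟨n, rfl⟩ := h
  rcases Nat.eq_zero_or_pos a with rfl | ha
  · simp [geomFactor]
  rw [geomFactor, geomFactor, Nat.mul_div_cancel_left n ha, ← Finset.sum_range_reflect,
    Finset.sum_mul, Finset.mul_sum]
  refine Finset.sum_congr rfl fun j hj => ?_
  have hj' := Finset.mem_range.1 hj
  rw [inv_pow, ← pow_add, eq_mul_inv_iff_mul_eq₀ (pow_ne_zero _ ht), ← pow_add, ← mul_add_one,
    ← mul_add]
  congr 2
  omega

lemma eval_eq_pow_mul_reflect {p : ℝ[X]} {n : ℕ} (hp : p.natDegree ≤ n) {t : ℝ} (ht : t ≠ 0) :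
    p.eval t = t ^ n * (reflect n p).eval t⁻¹ := by
  let := invertibleOfNonzero ht
  have := eval₂_reflect_mul_pow (RingHom.id ℝ) t n p hp
  rw [mul_comm, invOf_eq_inv] at this
  exact this.symm

/-- Comparison of two numerators over possibly different denominators, on the whole half-line. -/
theorem numerator_le_numerator {a b g N : ℕ} (hg : 0 < g) (hag : a ∣ g) (hbg : b ∣ g)
    {p r : ℝ[X]} (hp : p.natDegree ≤ a * N) (hr : r.natDegree ≤ b * N)
    {E₁ E₁' E₂ E₂' : PowerSeries ℝ}
    (hp1 : (p : PowerSeries ℝ) = (1 - PowerSeries.X ^ a) ^ N * E₁)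
    (hp2 : (reflect (a * N) p : PowerSeries ℝ) = (1 - PowerSeries.X ^ a) ^ N * E₁')
    (hr1 : (r : PowerSeries ℝ) = (1 - PowerSeries.X ^ b) ^ N * E₂)
    (hr2 : (reflect (b * N) r : PowerSeries ℝ) = (1 - PowerSeries.X ^ b) ^ N * E₂')
    (hE : ∀ n, PowerSeries.coeff n E₁ ≤ PowerSeries.coeff n E₂)
    (hE' : ∀ n, PowerSeries.coeff n E₁' ≤ PowerSeries.coeff n E₂') {t : ℝ} (ht : 0 ≤ t) :
    geomFactor a g t ^ N * p.eval t ≤ geomFactor b g t ^ N * r.eval t := by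
  have hgeom : ∀ {c : ℕ}, c ∣ g → ∀ {f : ℝ[X]} {E : PowerSeries ℝ},
      (f : PowerSeries ℝ) = (1 - PowerSeries.X ^ c) ^ N * E →
      ((geomPoly c g ^ N * f : ℝ[X]) : PowerSeries ℝ) = (1 - PowerSeries.X ^ g) ^ N * E := by
    intro c hc f E hf
    have h1 : ((geomPoly c g * (1 - X ^ c) : ℝ[X]) : PowerSeries ℝ) = 1 - PowerSeries.X ^ g := by
      rw [geomPoly_mul hc]
      push_cast
      rfl
    push_cast at h1
    push_cast
    rw [hf, ← mul_assoc, ← mul_pow, h1]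
  have hle : ∀ {f₁ f₂ : ℝ[X]} {e₁ e₂ : PowerSeries ℝ},
      (f₁ : PowerSeries ℝ) = (1 - PowerSeries.X ^ a) ^ N * e₁ →
      (f₂ : PowerSeries ℝ) = (1 - PowerSeries.X ^ b) ^ N * e₂ →
      (∀ n, PowerSeries.coeff n e₁ ≤ PowerSeries.coeff n e₂) → ∀ {s : ℝ}, 0 ≤ s → s ≤ 1 →
      geomFactor a g s ^ N * f₁.eval s ≤ geomFactor b g s ^ N * f₂.eval s := by
    intro f₁ f₂ e₁ e₂ h1 h2 he s hs0 hs1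
    have h := eval_nonneg_of_numerator hg (N := N)
      (H := geomPoly b g ^ N * f₂ - geomPoly a g ^ N * f₁) (E := e₂ - e₁) (by
        rw [Polynomial.coe_sub, hgeom hbg h2, hgeom hag h1, mul_sub])
      (fun n => by rw [map_sub]; exact sub_nonneg.2 (he n)) hs0 hs1
    simpa [eval_geomPoly] using h
  rcases le_or_gt t 1 with ht1 | ht1
  · exact hle hp1 hr1 hE ht ht1
  · have ht0 : t ≠ 0 := by positivity
    -- The power t^(gN) does not depend on `c`, so the comparison at t reduces to the one at 1/t for
    -- the reversed numerators.
    have hfac : ∀ {c : ℕ}, c ∣ g → ∀ {f : ℝ[X]}, f.natDegree ≤ c * N →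
        geomFactor c g t ^ N * f.eval t =
          t ^ (g * N) * (geomFactor c g t⁻¹ ^ N * (reflect (c * N) f).eval t⁻¹) := by
      intro c hc f hf
      rw [eval_eq_pow_mul_reflect hf ht0, pow_mul, pow_mul, ← mul_assoc, ← mul_assoc, ← mul_pow,
        ← mul_pow, geomFactor_inv hc ht0]
    rw [hfac hag hp, hfac hbg hr]
    exact mul_le_mul_of_nonneg_left
      (hle hp2 hr2 hE' (by positivity) (inv_le_one_of_one_le₀ ht1.le)) (by positivity)

end Evaluation

end WeightedEhrhart

namespace WeightedEhrhart

open Module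

/-! ### Weights as polynomial functions on a lattice. -/

section PolynomialFunctions

variable {A σ : Type*} [AddCommGroup A]

lemma DegLT.mul_pow {n : ℕ} {f : A → ℝ} (hf : DegLT n f) (l : A →+ ℝ) (k : ℕ) :
    DegLT (n + k) fun x => l x ^ k * f x := by
  induction k with
  | zero => simpa using hf
  | succ k ih =>
    have := ih.mul_hom l
    simp only [← mul_assoc, ← pow_succ'] at this
    exact this

lemma degLT_prod_pow (l : σ → A →+ ℝ) (s : σ → ℕ) (t : Finset σ) :
    DegLT (∑ i ∈ t, s i + 1) fun x => ∏ i ∈ t, l i x ^ s i := by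
  classical
  induction t using Finset.induction_on with
  | empty => simpa using degLT_const (A := A) 1
  | insert i t hi ih =>
    have := ih.mul_pow (l i) (s i)
    simp only [Finset.sum_insert hi, Finset.prod_insert hi]
    rwa [show s i + ∑ j ∈ t, s j + 1 = ∑ j ∈ t, s j + 1 + s i by ring]

lemma degLT_finsetSum {κ : Type*} {n : ℕ} (t : Finset κ) (f : κ → A → ℝ)
    (hf : ∀ i ∈ t, DegLT n (f i)) : DegLT n fun x => ∑ i ∈ t, f i x := by
  classical
  induction t using Finset.induction_on with
  | empty =>
    have : DegLT 0 fun _ : A => (0 : ℝ) := rfl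
    simpa using this.mono n.zero_le
  | insert i t hi ih =>
    simp only [Finset.sum_insert hi]
    exact (hf i (Finset.mem_insert_self _ _)).add
      (ih fun j hj => hf j (Finset.mem_insert_of_mem hj))

lemma degLT_eval (l : σ → A →+ ℝ) (w : MvPolynomial σ ℝ) {m : ℕ} (hw : w.totalDegree ≤ m) :
    DegLT (m + 1) fun x => MvPolynomial.eval (fun i => l i x) w := by
  simp only [MvPolynomial.eval_eq]
  refine degLT_finsetSum _ _ fun s hs => ?_
  refine DegLT.const_mul ((degLT_prod_pow l s s.support).mono ?_) _
  exact Nat.succ_le_succ ((MvPolynomial.le_totalDegree hs).trans hw)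

lemma eval_smul_of_isHomogeneous {w : MvPolynomial σ ℝ} {m : ℕ} (hw : w.IsHomogeneous m) (c : ℝ)
    (x : σ → ℝ) : MvPolynomial.eval (c • x) w = c ^ m * MvPolynomial.eval x w := by
  rw [MvPolynomial.eval_eq, MvPolynomial.eval_eq, Finset.mul_sum]
  refine Finset.sum_congr rfl fun s hs => ?_
  simp only [Pi.smul_apply, smul_eq_mul, mul_pow, Finset.prod_mul_distrib,
    Finset.prod_pow_eq_pow_sum, ← hw.degree_eq_sum_deg_support hs]
  ring

end PolynomialFunctions

/-! ### Rational polytopes and the cones over their vertices. -/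

section Polytopes

variable {d : ℕ} {K : Set (Fin d → ℝ)}

lemma IsRationalPolytope.finite_extremePoints (hK : IsRationalPolytope K) :
    (K.extremePoints ℝ).Finite := by
  obtain ⟨V, rfl⟩ := hK
  exact (V.finite_toSet.image _).subset extremePoints_convexHull_subset

lemma IsRationalPolytope.isCompact (hK : IsRationalPolytope K) : IsCompact K := by
  obtain ⟨V, rfl⟩ := hK
  exact (V.finite_toSet.image _).isCompact_convexHull ℝ

lemma IsRationalPolytope.convex (hK : IsRationalPolytope K) : Convex ℝ K := by
  obtain ⟨V, rfl⟩ := hK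
  exact convex_convexHull _ _

/-- Krein–Milman; no closure is needed, since the hull of finitely many points is compact. -/
lemma IsRationalPolytope.convexHull_extremePoints (hK : IsRationalPolytope K) :
    convexHull ℝ (K.extremePoints ℝ) = K := by
  have h := closure_convexHull_extremePoints hK.isCompact hK.convex
  rwa [(hK.finite_extremePoints.isCompact_convexHull ℝ).isClosed.closure_eq] at h

lemma IsRationalPolytope.denominator_spec (hK : IsRationalPolytope K) :
    0 < denominator K ∧ ∀ v ∈ K.extremePoints ℝ, ∀ i, ∃ z : ℤ, (denominator K : ℝ) * v i = z := by
  refine Nat.sInf_mem (s := {q : ℕ | 0 < q ∧ ∀ v ∈ K.extremePoints ℝ, ∀ i : Fin d,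
    ∃ z : ℤ, (q : ℝ) * v i = (z : ℝ)}) ?_
  obtain ⟨V, rfl⟩ := hK
  refine ⟨∏ v ∈ V, ∏ i, (v i).den,
    Finset.prod_pos fun v _ => Finset.prod_pos fun i _ => (v i).den_pos, fun x hx i => ?_⟩
  obtain ⟨v, hv, rfl⟩ := extremePoints_convexHull_subset hx
  obtain ⟨k, hk⟩ : (v i).den ∣ ∏ v ∈ V, ∏ i, (v i).den :=
    (Finset.dvd_prod_of_mem (fun i => (v i).den) (Finset.mem_univ i)).trans
      (Finset.dvd_prod_of_mem (fun v : Fin d → ℚ => ∏ i, (v i).den) hv)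
  refine ⟨k * (v i).num, ?_⟩
  have h : ((v i : ℚ) : ℝ) * (v i).den = (v i).num := by exact_mod_cast Rat.mul_den_eq_num (v i)
  rw [hk]
  push_cast
  linear_combination (k : ℝ) * h

@[simp] lemma lift_last (p : Fin d → ℝ) : lift p (Fin.last d) = 1 := by simp [lift]

@[simp] lemma lift_castSucc (p : Fin d → ℝ) (i : Fin d) : lift p i.castSucc = p i := by simp [lift]

lemma sum_smul_lift {κ : Type*} (s : Finset κ) (a : κ → ℝ) (p : κ → Fin d → ℝ)
    (ha : ∑ i ∈ s, a i = 1) : ∑ i ∈ s, a i • lift (p i) = lift (∑ i ∈ s, a i • p i) := by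
  ext j
  refine Fin.lastCases ?_ (fun j => ?_) j <;> simp [ha]

/-- The embedding of `ℝ ^ d` as the hyperplane at height zero. -/
noncomputable def hyperplaneEmbedding (d : ℕ) : (Fin d → ℝ) →ₗ[ℝ] (Fin (d + 1) → ℝ) where
  toFun p := Fin.snoc (α := fun _ => ℝ) p 0
  map_add' p q := by
    ext j
    refine Fin.lastCases ?_ (fun j => ?_) j <;> simp
  map_smul' c p := by
    ext j
    refine Fin.lastCases ?_ (fun j => ?_) j <;> simp

lemma hyperplaneEmbedding_sub (p q : Fin d → ℝ) :
    hyperplaneEmbedding d (p - q) = lift p - lift q := by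
  ext j
  refine Fin.lastCases ?_ (fun j => ?_) j <;> simp [hyperplaneEmbedding]

lemma hyperplaneEmbedding_injective : Function.Injective (hyperplaneEmbedding d) := by
  intro p q h
  ext j
  have := congrFun h j.castSucc
  simpa [hyperplaneEmbedding] using this

lemma span_lift_eq {p : Fin d → ℝ} (hp : p ∈ K) :
    Submodule.span ℝ (lift '' K) =
      (vectorSpan ℝ K).map (hyperplaneEmbedding d) ⊔ Submodule.span ℝ {lift p} := by
  apply le_antisymm
  · rw [Submodule.span_le]
    rintro _ ⟨x, hx, rfl⟩
    have h : lift x = hyperplaneEmbedding d (x -ᵥ p) + lift p := by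
      rw [vsub_eq_sub, hyperplaneEmbedding_sub, sub_add_cancel]
    rw [h]
    exact Submodule.add_mem_sup (Submodule.mem_map_of_mem (vsub_mem_vectorSpan ℝ hx hp))
      (Submodule.mem_span_singleton_self _)
  · refine sup_le ?_ (Submodule.span_mono (by simpa using ⟨p, hp, rfl⟩))
    rw [vectorSpan, Submodule.map_span, Submodule.span_le]
    rintro _ ⟨_, ⟨x, hx, y, hy, rfl⟩, rfl⟩
    simp only [vsub_eq_sub, hyperplaneEmbedding_sub]
    exact Submodule.sub_mem _ (Submodule.subset_span ⟨x, hx, rfl⟩)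
      (Submodule.subset_span ⟨y, hy, rfl⟩)

/-- The span is the direction space at height 0 plus a line through a point at height 1. -/
lemma finrank_span_lift (hK : K.Nonempty) :
    finrank ℝ (Submodule.span ℝ (lift '' K)) = polytopeDim K + 1 := by
  obtain ⟨p, hp⟩ := hK
  have hne : lift p ≠ 0 := fun h => by
    have := congrFun h (Fin.last d)
    simp at this
  have hinf : (vectorSpan ℝ K).map (hyperplaneEmbedding d) ⊓ Submodule.span ℝ {lift p} = ⊥ := by
    rw [eq_bot_iff]
    rintro _ ⟨⟨x, -, rfl⟩, hx⟩
    obtain ⟨c, hc⟩ := Submodule.mem_span_singleton.1 hx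
    have h := congrFun hc (Fin.last d)
    have hc0 : c = 0 := by simpa [hyperplaneEmbedding] using h
    rw [← hc, hc0, zero_smul]
    exact Submodule.zero_mem _
  have h := Submodule.finrank_sup_add_finrank_inf_eq
    ((vectorSpan ℝ K).map (hyperplaneEmbedding d)) (Submodule.span ℝ {lift p})
  rw [hinf, finrank_bot, add_zero, finrank_span_singleton hne, ← span_lift_eq hp,
    ← (Submodule.equivMapOfInjective _ hyperplaneEmbedding_injective _).finrank_eq] at h
  exact h

lemma cone_mono {P Q : Set (Fin d → ℝ)} (h : P ⊆ Q) : cone P ⊆ cone Q := by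
  rintro _ ⟨c, hc, p, hp, rfl⟩
  exact ⟨c, hc, p, h hp, rfl⟩

lemma cone_subset_span : cone K ⊆ Submodule.span ℝ (lift '' K) := by
  rintro _ ⟨c, -, p, hp, rfl⟩
  exact Submodule.smul_mem _ _ (Submodule.subset_span ⟨p, hp, rfl⟩)

/-- The vector of a vertex of a polytope inside a subspace containing the lifted polytope. -/
def vertexVector {W : Submodule ℝ (Fin (d + 1) → ℝ)} (hW : lift '' K ⊆ W)
    (v : K.extremePoints ℝ) : W :=
  ⟨lift v.1, hW ⟨v.1, extremePoints_subset v.2, rfl⟩⟩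

/-- Normalizing by the total coefficient turns conic combinations into convex ones. Nonemptiness
matters: `cone ∅` is empty, whereas the empty family generates the origin. -/
lemma mem_posCone_vertexVector [Fintype (K.extremePoints ℝ)] (hK : IsRationalPolytope K)
    (hne : K.Nonempty) {W : Submodule ℝ (Fin (d + 1) → ℝ)} (hW : lift '' K ⊆ W) (x : W) :
    x ∈ posCone (vertexVector hW) ↔ (x : Fin (d + 1) → ℝ) ∈ cone K := by
  constructor
  · rintro ⟨a, ha, rfl⟩
    have hsum : ((∑ v, a v • vertexVector hW v : W) : Fin (d + 1) → ℝ) = ∑ v, a v • lift v.1 := by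
      simp [vertexVector]
    rw [hsum]
    rcases (Finset.sum_nonneg fun v (_ : v ∈ Finset.univ) => ha v).eq_or_lt with h0 | hpos
    · have h := (Finset.sum_eq_zero_iff_of_nonneg fun v _ => ha v).1 h0.symm
      obtain ⟨p, hp⟩ := hne
      refine ⟨0, le_rfl, p, hp, ?_⟩
      rw [zero_smul]
      exact Finset.sum_eq_zero fun v hv => by rw [h v hv, zero_smul]
    · set c := ∑ v, a v with hc
      have h1 : ∑ v, a v / c = 1 := by rw [← Finset.sum_div, div_self hpos.ne']
      refine ⟨c, hpos.le, ∑ v, (a v / c) • v.1, ?_, ?_⟩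
      · exact hK.convex.sum_mem (fun v _ => div_nonneg (ha v) hpos.le) h1
          fun v _ => extremePoints_subset v.2
      · rw [← sum_smul_lift _ _ _ h1, Finset.smul_sum]
        refine Finset.sum_congr rfl fun v _ => ?_
        rw [smul_smul, mul_div_cancel₀ _ hpos.ne']
  · rintro ⟨c, hc, p, hp, hx⟩
    rw [← hK.convexHull_extremePoints, ← Set.coe_toFinset (K.extremePoints ℝ),
      Finset.mem_convexHull'] at hp
    obtain ⟨b, hb, hb1, hbp⟩ := hp
    refine ⟨fun v => c * b v.1, fun v => mul_nonneg hc (hb _ (by simp)), ?_⟩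
    apply Subtype.ext
    have hsum : ((∑ v, (c * b v.1) • vertexVector hW v : W) : Fin (d + 1) → ℝ) =
        ∑ v : K.extremePoints ℝ, (c * b v.1) • lift v.1 := by
      simp [vertexVector]
    rw [hsum, hx, ← hbp, ← sum_smul_lift _ _ _ hb1, Finset.smul_sum]
    rw [← Finset.sum_set_coe]
    exact Finset.sum_congr rfl fun v _ => mul_smul _ _ _

end Polytopes

end WeightedEhrhart

namespace WeightedEhrhart

open Module

/-! ### Lattice sums by level, in the ambient space and in the span. -/

section LevelSeries

variable {d : ℕ}

/-- The series of the weighted lattice point sums of a set over the levels of the last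
coordinate. -/
noncomputable def levelSeries (C : Set (Fin (d + 1) → ℝ)) (w : MvPolynomial (Fin (d + 1)) ℝ) :
    PowerSeries ℝ :=
  PowerSeries.mk fun n =>
    ∑ᶠ x ∈ {x : Fin (d + 1) → ℤ | (fun i => (x i : ℝ)) ∈ C ∧ x (Fin.last d) = (n : ℤ)},
      MvPolynomial.eval (fun i => (x i : ℝ)) w

lemma ehrhartSeries_eq_levelSeries (K : Set (Fin d → ℝ)) (w : MvPolynomial (Fin (d + 1)) ℝ) :
    ehrhartSeries K w = levelSeries (cone K) w := rfl

/-- The points of the cone over `K` that stay in the cone when they move a little against `ξ`. -/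
def dualCone (K : Set (Fin d → ℝ)) (ξ : Fin (d + 1) → ℝ) : Set (Fin (d + 1) → ℝ) :=
  {x | ∃ ε : ℝ, 0 < ε ∧ x - ε • ξ ∈ cone K}

/-- At level `k` the scaling factor is `k` itself, so the points are bounded. -/
lemma finite_level {K : Set (Fin d → ℝ)} (hK : IsCompact K) (k : ℤ) :
    {x : Fin (d + 1) → ℤ | (fun i => (x i : ℝ)) ∈ cone K ∧ x (Fin.last d) = k}.Finite := by
  obtain ⟨R, hR⟩ := hK.isBounded.exists_norm_le
  set M : ℝ := |(k : ℝ)| * max R 1 with hM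
  refine ((isCompact_closedBall (0 : Fin (d + 1) → ℤ) M).finite_of_discrete).subset ?_
  rintro x ⟨⟨c, hc, p, hp, hx⟩, hk⟩
  have hck : c = k := by
    have := congrFun hx (Fin.last d)
    simpa [hk] using this.symm
  have hM0 : 0 ≤ M := by positivity
  rw [mem_closedBall_zero_iff, pi_norm_le_iff_of_nonneg hM0]
  intro i
  have hxi : (x i : ℝ) = c * lift p i := congrFun hx i
  have hl : |lift p i| ≤ max R 1 := by
    refine Fin.lastCases ?_ (fun j => ?_) i
    · simp
    · rw [lift_castSucc]
      exact ((norm_le_pi_norm p j).trans (hR p hp)).trans (le_max_left _ _)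
  rw [Int.norm_eq_abs, hxi, abs_mul, hM, hck]
  exact mul_le_mul_of_nonneg_left hl (abs_nonneg _)

lemma coeff_levelSeries_mono {K : Set (Fin d → ℝ)} (hK : IsCompact K)
    {w : MvPolynomial (Fin (d + 1)) ℝ} (hw : ∀ x ∈ cone K, 0 ≤ MvPolynomial.eval x w)
    {C C' : Set (Fin (d + 1) → ℝ)} (hC : C ⊆ C') (hC' : C' ⊆ cone K) (n : ℕ) :
    PowerSeries.coeff n (levelSeries C w) ≤ PowerSeries.coeff n (levelSeries C' w) := by
  have hfin' : {x : Fin (d + 1) → ℤ | (fun i => (x i : ℝ)) ∈ C' ∧ x (Fin.last d) = (n : ℤ)}.Finite :=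
    (finite_level hK n).subset fun x hx => ⟨hC' hx.1, hx.2⟩
  have hsub : {x : Fin (d + 1) → ℤ | (fun i => (x i : ℝ)) ∈ C ∧ x (Fin.last d) = (n : ℤ)} ⊆
      {x : Fin (d + 1) → ℤ | (fun i => (x i : ℝ)) ∈ C' ∧ x (Fin.last d) = (n : ℤ)} :=
    fun x hx => ⟨hC hx.1, hx.2⟩
  have hfin := hfin'.subset hsub
  rw [levelSeries, levelSeries, PowerSeries.coeff_mk, PowerSeries.coeff_mk,
    finsum_mem_eq_finite_toFinset_sum _ hfin, finsum_mem_eq_finite_toFinset_sum _ hfin']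
  refine Finset.sum_le_sum_of_subset_of_nonneg (by simpa using hsub) fun x hx _ => hw _ (hC' ?_)
  exact ((Set.Finite.mem_toFinset _).1 hx).1

lemma levelSeries_empty (w : MvPolynomial (Fin (d + 1)) ℝ) : levelSeries ∅ w = 0 := by
  ext n
  simp [levelSeries]

lemma levelSeries_zero (C : Set (Fin (d + 1) → ℝ)) : levelSeries C 0 = 0 := by
  ext n
  simp [levelSeries]

/-- The integer points as real points. -/
def castHom (d : ℕ) : (Fin (d + 1) → ℤ) →+ (Fin (d + 1) → ℝ) :=
  (Int.castAddHom ℝ).compLeft _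

/-- The integer points of a subspace. -/
def latticeIn (W : Submodule ℝ (Fin (d + 1) → ℝ)) : AddSubgroup (Fin (d + 1) → ℤ) :=
  W.toAddSubgroup.comap (castHom d)

/-- The inclusion of the integer points of a subspace. -/
def latticeIncl (W : Submodule ℝ (Fin (d + 1) → ℝ)) : latticeIn W →+ W where
  toFun x := ⟨castHom d x, x.2⟩
  map_zero' := Subtype.ext (by simp)
  map_add' x y := Subtype.ext (by simp)

/-- The last coordinate as the height of a lattice point. -/
def latticeHeight (W : Submodule ℝ (Fin (d + 1) → ℝ)) : latticeIn W →+ ℤ :=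
  (Pi.evalAddMonoidHom (fun _ => ℤ) (Fin.last d)).comp (latticeIn W).subtype

/-- The weight as a function on the integer points of a subspace. -/
noncomputable def latticeWeight (W : Submodule ℝ (Fin (d + 1) → ℝ))
    (w : MvPolynomial (Fin (d + 1)) ℝ) (x : latticeIn W) : ℝ :=
  MvPolynomial.eval (fun i => (x.1 i : ℝ)) w

open Classical in
lemma toSeries_fiberSum (W : Submodule ℝ (Fin (d + 1) → ℝ)) (w : MvPolynomial (Fin (d + 1)) ℝ)
    {C : Set (Fin (d + 1) → ℝ)} (hC : C ⊆ W) {C' : Set W} (hC' : ∀ x : W, x ∈ C' ↔ x.1 ∈ C) :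
    toSeries (fiberSum (latticeHeight W)
      fun x => latticeWeight W w x * if latticeIncl W x ∈ C' then 1 else 0) = levelSeries C w := by
  ext n
  rw [toSeries, levelSeries, PowerSeries.coeff_mk, PowerSeries.coeff_mk, fiberSum]
  rw [finsum_mem_inter_support_eq' _ _ {x | latticeHeight W x = n ∧ latticeIncl W x ∈ C'}]
  · refine finsum_mem_eq_of_bijOn Subtype.val ⟨fun x hx => ?_, Subtype.val_injective.injOn,
      fun x hx => ?_⟩ fun x hx => ?_
    · exact ⟨(hC' _).1 hx.2, hx.1⟩
    · exact ⟨⟨x, hC hx.1⟩, ⟨hx.2, (hC' _).2 hx.1⟩, rfl⟩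
    · rw [if_pos hx.2, mul_one, latticeWeight]
  · intro x hx
    have : latticeIncl W x ∈ C' := by
      by_contra h
      simp [h] at hx
    simp [this]

end LevelSeries

/-! ### Reciprocity for a single polytope. -/

section Main

variable {d : ℕ} {K : Set (Fin d → ℝ)}

/-- A nonnegative combination of height zero is the origin, which is not generic. Positivity of this
height makes the dual series start at level 1. -/
lemma pos_of_generic {ι V : Type*} [Fintype ι] [Nonempty ι] [NormedAddCommGroup V]
    [NormedSpace ℝ V] {u : ι → V} {l : V →ₗ[ℝ] ℝ} (hl : ∀ i, l (u i) = 1) {ξ : V}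
    (hξ : Generic u ξ) (hξC : ξ ∈ posCone u) : 0 < l ξ := by
  have hne : ξ ≠ 0 := by
    rintro rfl
    refine hξ ∅ ?_ (Submodule.zero_mem _)
    rw [Set.image_empty, Submodule.span_empty]
    intro h
    have hu : u (Classical.arbitrary ι) ∈ (⊥ : Submodule ℝ V) := h ▸ Submodule.mem_top
    have := hl (Classical.arbitrary ι)
    rw [(Submodule.mem_bot ℝ).1 hu, map_zero] at this
    exact zero_ne_one this
  obtain ⟨a, ha, rfl⟩ := hξC
  have hla : l (∑ i, a i • u i) = ∑ i, a i := by simp [hl]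
  rw [hla]
  refine (Finset.sum_nonneg fun i _ => ha i).lt_of_ne fun h0 => hne ?_
  have h := (Finset.sum_eq_zero_iff_of_nonneg fun i _ => ha i).1 h0.symm
  exact Finset.sum_eq_zero fun i hi => by rw [h i hi, zero_smul]

/-- The last coordinate on a subspace. -/
noncomputable def lastCoord (W : Submodule ℝ (Fin (d + 1) → ℝ)) : W →ₗ[ℝ] ℝ :=
  (LinearMap.proj (Fin.last d)).comp W.subtype

/-- Rationality and reciprocity for the weighted Ehrhart series of a nonempty polytope. -/
theorem hStar_spec (hK : IsRationalPolytope K) (hne : K.Nonempty)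
    {w : MvPolynomial (Fin (d + 1)) ℝ} {m : ℕ} (hw : w.IsHomogeneous m) (hw0 : w ≠ 0)
    {W : Submodule ℝ (Fin (d + 1) → ℝ)} (hspan : Submodule.span ℝ (lift '' K) = W)
    (hW : lift '' K ⊆ W) {ξ : W} (hξ : Generic (vertexVector hW) ξ) (hξK : ξ.1 ∈ cone K) :
    IsHStar K w (hStar K w) ∧
      (Polynomial.reflect (denominator K * (polytopeDim K + m + 1)) (hStar K w) : PowerSeries ℝ) =
        (1 - PowerSeries.X ^ denominator K) ^ (polytopeDim K + m + 1) *
          levelSeries (dualCone K ξ) w := by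
  classical
  have hdeg := hw.totalDegree hw0
  have hrank : finrank ℝ W = polytopeDim K + 1 := by rw [← hspan, finrank_span_lift hne]
  obtain ⟨hq, hqv⟩ := hK.denominator_spec
  let := hK.finite_extremePoints.fintype
  have hmem := mem_posCone_vertexVector hK hne hW
  have hnev : Nonempty (K.extremePoints ℝ) := by
    obtain ⟨p, hp⟩ := hne
    rw [← hK.convexHull_extremePoints] at hp
    exact (convexHull_nonempty_iff.1 ⟨p, hp⟩).to_subtype
  have hl : ∀ v, lastCoord W (vertexVector hW v) = 1 := fun v => lift_last v.1
  have hξC : ξ ∈ posCone (vertexVector hW) := (hmem ξ).2 hξK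
  choose z hz using fun v : K.extremePoints ℝ => hqv v.1 v.2
  have hcast : ∀ v : K.extremePoints ℝ,
      castHom d (Fin.snoc (α := fun _ => ℤ) (z v) (denominator K)) =
        (denominator K : ℝ) • lift v.1 := by
    intro v
    ext j
    refine Fin.lastCases ?_ (fun j => ?_) j <;> simp [castHom, hz]
  -- The lattice vectors δ(K)(v, 1) all have height δ(K), so every generator contributes a
  -- difference of the same step.
  let g : K.extremePoints ℝ → latticeIn W := fun v =>
    ⟨Fin.snoc (α := fun _ => ℤ) (z v) (denominator K), by
      change castHom d _ ∈ W
      rw [hcast]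
      exact W.smul_mem _ (hW ⟨v.1, extremePoints_subset v.2, rfl⟩)⟩
  have hg : ∀ v, latticeIncl W (g v) = (((denominator K : ℕ) : ℤ) : ℝ) • vertexVector hW v :=
    fun v => Subtype.ext (by rw [Int.cast_natCast]; exact hcast v)
  have hgh : ∀ v, latticeHeight W (g v) = (denominator K : ℕ) := fun v => by
    simp [latticeHeight, g]
  have hfin : ∀ k, {x : latticeIn W | latticeHeight W x = k ∧
      latticeIncl W x ∈ posCone (vertexVector hW)}.Finite := fun k =>
    ((finite_level hK.isCompact k).preimage Subtype.val_injective.injOn).subset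
      fun x hx => ⟨(hmem _).1 hx.2, hx.1⟩
  have hwdeg : DegLT (m + 1) (latticeWeight W w) :=
    degLT_eval (fun i => ((Int.castAddHom ℝ).comp (Pi.evalAddMonoidHom (fun _ => ℤ) i)).comp
      (latticeIn W).subtype) w hdeg.le
  have hwneg : ∀ x, latticeWeight W w (-x) = (-1) ^ m * latticeWeight W w x := fun x => by
    rw [latticeWeight, latticeWeight, ← eval_smul_of_isHomogeneous hw]
    congr 2
    ext i
    simp
  have hrec := weighted_reciprocity (lastCoord W) hl hg hgh hfin hξ hξC hwdeg hwneg
  have hheight : ∀ x : latticeIn W, lastCoord W (latticeIncl W x) = latticeHeight W x :=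
    fun x => rfl
  have hnonneg : ∀ x ∈ posCone (vertexVector hW), 0 ≤ lastCoord W x := by
    rintro _ ⟨a, ha, rfl⟩
    simpa [hl] using Finset.sum_nonneg fun v _ => ha v
  have hF : ∀ k < 0, fiberSum (latticeHeight W) (fun x => latticeWeight W w x *
      if latticeIncl W x ∈ posCone (vertexVector hW) then 1 else 0) k = 0 := by
    intro k hk
    refine finsum_mem_eq_zero_of_forall_eq_zero fun x hx => ?_
    rw [if_neg, mul_zero]
    intro h
    have h1 := hnonneg _ h
    rw [hheight, show latticeHeight W x = k from hx] at h1
    exact absurd h1 (by exact_mod_cast hk.not_ge)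
  have hF' : ∀ k < 1, fiberSum (latticeHeight W) (fun x => latticeWeight W w x *
      if latticeIncl W x ∈ shiftedCone (vertexVector hW) ξ then 1 else 0) k = 0 := by
    intro k hk
    refine finsum_mem_eq_zero_of_forall_eq_zero fun x hx => ?_
    rw [if_neg, mul_zero]
    rintro ⟨ε, hε, h⟩
    have h1 := hnonneg _ h
    rw [map_sub, map_smul, hheight, show latticeHeight W x = k from hx, smul_eq_mul] at h1
    have h2 := mul_pos hε (pos_of_generic hl hξ hξC)
    have h3 : (0 : ℝ) < k := by linarith
    have : 0 < k := by exact_mod_cast h3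
    omega
  have hmain := numerator_of_reciprocity hF hF' hrec
  have hconeW : cone K ⊆ W := hspan ▸ cone_subset_span
  have hshift : ∀ x : W, x ∈ shiftedCone (vertexVector hW) ξ ↔ x.1 ∈ dualCone K ξ := fun x =>
    exists_congr fun ε => and_congr_right fun _ => hmem _
  have hdualW : dualCone K ξ ⊆ W := by
    rintro x ⟨ε, -, hx⟩
    have := W.add_mem (hconeW hx) (W.smul_mem ε ξ.2)
    simpa using this
  rw [toSeries_fiberSum W w hconeW hmem, toSeries_fiberSum W w hdualW hshift, hrank,
    show polytopeDim K + 1 + m = polytopeDim K + m + 1 by ring,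
    ← ehrhartSeries_eq_levelSeries] at hmain
  rw [IsHStar, hStar, hdeg]
  exact hmain

lemma cone_nonneg {Q : Set (Fin d → ℝ)} {w : MvPolynomial (Fin (d + 1)) ℝ} {m : ℕ}
    (hwS : w ∈ semiringS Q) (hwm : w.IsHomogeneous m) : ∀ x ∈ cone Q, 0 ≤ MvPolynomial.eval x w := by
  rintro _ ⟨c, hc, p, hp, rfl⟩
  rw [eval_smul_of_isHomogeneous hwm]
  refine mul_nonneg (pow_nonneg hc m) ?_
  -- Homogeneity has served to reduce to height 1; the summands of `w` need not be homogeneous of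
  -- degree `m`.
  clear hwm
  induction hwS using AddSubmonoid.closure_induction with
  | mem f hf =>
    obtain ⟨c, k, ℓ, hc, -, hpos, rfl⟩ := hf
    rw [map_mul, MvPolynomial.eval_C]
    exact mul_nonneg hc (hpos p hp)
  | zero => simp
  | add f g _ _ hf hg =>
    rw [map_add]
    exact add_nonneg hf hg

end Main

end WeightedEhrhart

namespace WeightedEhrhart

/-! ### A direction common to both polytopes, and degenerate cases. -/

section Comparison

variable {d : ℕ} {K : Set (Fin d → ℝ)}

lemma cone_empty : cone (∅ : Set (Fin d → ℝ)) = ∅ := by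
  ext
  simp [cone]

lemma dualCone_empty (ξ : Fin (d + 1) → ℝ) : dualCone (∅ : Set (Fin d → ℝ)) ξ = ∅ := by
  ext
  simp [dualCone, cone_empty]

lemma hStar_eq_zero {w : MvPolynomial (Fin (d + 1)) ℝ} (h : ehrhartSeries K w = 0) :
    hStar K w = 0 := by
  rw [hStar, h, mul_zero, map_zero]

lemma isHStar_of_eq_zero {w : MvPolynomial (Fin (d + 1)) ℝ} (h : ehrhartSeries K w = 0) :
    IsHStar K w (hStar K w) := by
  rw [IsHStar, hStar_eq_zero h, h, mul_zero, Polynomial.coe_zero]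

lemma ehrhartSeries_empty (w : MvPolynomial (Fin (d + 1)) ℝ) :
    ehrhartSeries (∅ : Set (Fin d → ℝ)) w = 0 := by
  rw [ehrhartSeries_eq_levelSeries, cone_empty, levelSeries_empty]

lemma ehrhartSeries_zero (K : Set (Fin d → ℝ)) : ehrhartSeries K 0 = 0 := by
  rw [ehrhartSeries_eq_levelSeries, levelSeries_zero]

lemma natDegree_hStar_le (K : Set (Fin d → ℝ)) (w : MvPolynomial (Fin (d + 1)) ℝ) :
    (hStar K w).natDegree ≤ denominator K * (polytopeDim K + w.totalDegree + 1) :=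
  Polynomial.natDegree_le_of_degree_le (PowerSeries.degree_trunc_lt _ _).le

lemma cone_add (hK : IsRationalPolytope K) {x y : Fin (d + 1) → ℝ} (hx : x ∈ cone K)
    (hy : y ∈ cone K) : x + y ∈ cone K := by
  have hne : K.Nonempty := by
    obtain ⟨_, _, p, hp, _⟩ := hx
    exact ⟨p, hp⟩
  let := hK.finite_extremePoints.fintype
  have h := mem_posCone_vertexVector hK hne (W := ⊤) (fun _ _ => trivial)
  exact (h (⟨x, trivial⟩ + ⟨y, trivial⟩)).1
    (posCone_add ((h ⟨x, trivial⟩).2 hx) ((h ⟨y, trivial⟩).2 hy))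

lemma cone_smul {x : Fin (d + 1) → ℝ} (hx : x ∈ cone K) {c : ℝ} (hc : 0 ≤ c) :
    c • x ∈ cone K := by
  obtain ⟨b, hb, p, hp, rfl⟩ := hx
  exact ⟨c * b, mul_nonneg hc hb, p, hp, smul_smul _ _ _⟩

lemma dualCone_mono {P Q : Set (Fin d → ℝ)} (h : P ⊆ Q) (ξ : Fin (d + 1) → ℝ) :
    dualCone P ξ ⊆ dualCone Q ξ := fun _ ⟨ε, hε, hx⟩ => ⟨ε, hε, cone_mono h hx⟩

lemma dualCone_subset_cone (hK : IsRationalPolytope K) {ξ : Fin (d + 1) → ℝ} (hξ : ξ ∈ cone K) :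
    dualCone K ξ ⊆ cone K := by
  rintro x ⟨ε, hε, hx⟩
  simpa using cone_add hK hx (cone_smul hξ hε.le)

lemma exists_mem_cone_forall_notMem (hK : IsRationalPolytope K) (hne : K.Nonempty)
    {W : Submodule ℝ (Fin (d + 1) → ℝ)} (hW : Submodule.span ℝ (lift '' K) = W)
    {𝓔 : Set (Submodule ℝ W)} (hfin : 𝓔.Finite) (hproper : ∀ E ∈ 𝓔, E ≠ ⊤) :
    ∃ ξ : W, ξ.1 ∈ cone K ∧ ∀ E ∈ 𝓔, ξ ∉ E := by
  subst hW
  refine exists_mem_forall_notMem (C := Subtype.val ⁻¹' cone K) ?_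
    (fun x hx y hy => Set.mem_preimage.2 (cone_add hK (Set.mem_preimage.1 hx) hy))
    (fun x hx c hc => Set.mem_preimage.2 (cone_smul (Set.mem_preimage.1 hx) (le_of_lt hc))) ?_ hfin hproper
  · obtain ⟨p, hp⟩ := hne
    exact ⟨0, 0, le_rfl, p, hp, (zero_smul _ _).symm⟩
  · rw [eq_top_iff, ← Submodule.span_span_coe_preimage]
    refine Submodule.span_mono ?_
    rintro x ⟨p, hp, hx⟩
    exact ⟨1, zero_le_one, p, hp, by rw [one_smul, hx]⟩

/-- The proper subspaces spanned by members of a family. -/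
def properSpans {ι V : Type*} [AddCommGroup V] [Module ℝ V] (u : ι → V) : Set (Submodule ℝ V) :=
  {E | E ≠ ⊤ ∧ ∃ S : Set ι, Submodule.span ℝ (u '' S) = E}

lemma finite_properSpans {ι V : Type*} [Finite ι] [AddCommGroup V] [Module ℝ V] (u : ι → V) :
    (properSpans u).Finite :=
  (Set.finite_range fun S : Set ι => Submodule.span ℝ (u '' S)).subset fun _ h => h.2

lemma generic_of_forall_notMem {ι V : Type*} [NormedAddCommGroup V] [NormedSpace ℝ V]
    {u : ι → V} {ξ : V} (h : ∀ E ∈ properSpans u, ξ ∉ E) : Generic u ξ :=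
  fun S hS => h _ ⟨hS, S, rfl⟩

/-- One direction in which the reciprocity laws of two nested polytopes of the same dimension hold
simultaneously. -/
lemma exists_common_direction {P Q : Set (Fin d → ℝ)} (hP : IsRationalPolytope P)
    (hQ : IsRationalPolytope Q) (hPQ : P ⊆ Q) (hdim : polytopeDim P = polytopeDim Q)
    {w : MvPolynomial (Fin (d + 1)) ℝ} {m : ℕ} (hw : w.IsHomogeneous m) (hw0 : w ≠ 0) :
    ∃ ξ : Fin (d + 1) → ℝ, dualCone Q ξ ⊆ cone Q ∧ ∀ K ∈ ({P, Q} : Set (Set (Fin d → ℝ))),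
      IsHStar K w (hStar K w) ∧
      (Polynomial.reflect (denominator K * (polytopeDim K + m + 1)) (hStar K w) : PowerSeries ℝ) =
        (1 - PowerSeries.X ^ denominator K) ^ (polytopeDim K + m + 1) *
          levelSeries (dualCone K ξ) w := by
  have hempty : ∀ {K : Set (Fin d → ℝ)}, K = ∅ → ∀ ξ : Fin (d + 1) → ℝ,
      IsHStar K w (hStar K w) ∧
      (Polynomial.reflect (denominator K * (polytopeDim K + m + 1)) (hStar K w) : PowerSeries ℝ) =
        (1 - PowerSeries.X ^ denominator K) ^ (polytopeDim K + m + 1) *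
          levelSeries (dualCone K ξ) w := by
    rintro _ rfl ξ
    refine ⟨isHStar_of_eq_zero (ehrhartSeries_empty w), ?_⟩
    rw [hStar_eq_zero (ehrhartSeries_empty w), dualCone_empty, levelSeries_empty, mul_zero,
      Polynomial.reflect_zero, Polynomial.coe_zero]
  simp only [Set.mem_insert_iff, Set.mem_singleton_iff, forall_eq_or_imp, forall_eq]
  rcases Q.eq_empty_or_nonempty with hQe | hQne
  · have hPe : P = ∅ := Set.subset_eq_empty hPQ hQe
    refine ⟨0, ?_, hempty hPe 0, hempty hQe 0⟩
    rw [hQe, dualCone_empty]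
    exact Set.empty_subset _
  have := hQ.finite_extremePoints.to_subtype
  set W := Submodule.span ℝ (lift '' Q) with hW
  have hQW : lift '' Q ⊆ W := Submodule.subset_span
  have hproper : ∀ {ι : Type} {u : ι → W}, ∀ E ∈ properSpans u, E ≠ ⊤ := fun E hE => hE.1
  rcases P.eq_empty_or_nonempty with hPe | hPne
  -- All series of the empty polytope vanish, so the direction need only suit `Q`.
  · obtain ⟨ξ, hξ, hgen⟩ := exists_mem_cone_forall_notMem hQ hQne hW.symm
      (finite_properSpans (vertexVector hQW)) hproper
    exact ⟨ξ, dualCone_subset_cone hQ hξ, hempty hPe ξ,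
      hStar_spec hQ hQne hw hw0 hW.symm hQW (generic_of_forall_notMem hgen) hξ⟩
  · have := hP.finite_extremePoints.to_subtype
    have hPW : lift '' P ⊆ W := (Set.image_mono hPQ).trans hQW
    -- Equal dimension forces equal spans, so a vector of the smaller cone can avoid the proper
    -- spans of both vertex families.
    have hspan : Submodule.span ℝ (lift '' P) = W :=
      Submodule.eq_of_le_of_finrank_eq (Submodule.span_le.2 hPW) (by
        rw [finrank_span_lift hPne, hW, finrank_span_lift hQne, hdim])
    obtain ⟨ξ, hξ, hgen⟩ := exists_mem_cone_forall_notMem hP hPne hspan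
      ((finite_properSpans (vertexVector hPW)).union (finite_properSpans (vertexVector hQW)))
      (fun E hE => hE.elim (fun h => h.1) fun h => h.1)
    exact ⟨ξ, dualCone_subset_cone hQ (cone_mono hPQ hξ),
      hStar_spec hP hPne hw hw0 hspan hPW
        (generic_of_forall_notMem fun E hE => hgen E (Or.inl hE)) hξ,
      hStar_spec hQ hQne hw hw0 hW.symm hQW
        (generic_of_forall_notMem fun E hE => hgen E (Or.inr hE)) (cone_mono hPQ hξ)⟩

lemma geomFactor_self {q : ℕ} (hq : 0 < q) (t : ℝ) : geomFactor q q t = 1 := by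
  simp [geomFactor, Nat.div_self hq]

end Comparison

end WeightedEhrhart

theorem theorem2p8 {d : ℕ} (P Q : Set (Fin d → ℝ))
    (hP : WeightedEhrhart.IsRationalPolytope P) (hQ : WeightedEhrhart.IsRationalPolytope Q)
    (hPQ : P ⊆ Q) (D : ℕ)
    (hDP : WeightedEhrhart.polytopeDim P = D) (hDQ : WeightedEhrhart.polytopeDim Q = D)
    (m : ℕ) (w : MvPolynomial (Fin (d + 1)) ℝ)
    (hwS : w ∈ WeightedEhrhart.semiringS Q) (hwm : w.IsHomogeneous m) :
    WeightedEhrhart.IsHStar P w (WeightedEhrhart.hStar P w) ∧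
    WeightedEhrhart.IsHStar Q w (WeightedEhrhart.hStar Q w) ∧
    (∀ g : ℕ, 0 < g → WeightedEhrhart.denominator P ∣ g → WeightedEhrhart.denominator Q ∣ g →
      ∀ t : ℝ, 0 ≤ t →
        WeightedEhrhart.geomFactor (WeightedEhrhart.denominator P) g t ^ (D + m + 1) *
            (WeightedEhrhart.hStar P w).eval t ≤
          WeightedEhrhart.geomFactor (WeightedEhrhart.denominator Q) g t ^ (D + m + 1) *
            (WeightedEhrhart.hStar Q w).eval t) ∧
    (WeightedEhrhart.denominator P = WeightedEhrhart.denominator Q →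
      ∀ t : ℝ, 0 ≤ t →
        (WeightedEhrhart.hStar P w).eval t ≤ (WeightedEhrhart.hStar Q w).eval t) := by
  open WeightedEhrhart in
  have hmain : IsHStar P w (hStar P w) ∧ IsHStar Q w (hStar Q w) ∧
      ∀ g : ℕ, 0 < g → denominator P ∣ g → denominator Q ∣ g → ∀ t : ℝ, 0 ≤ t →
        geomFactor (denominator P) g t ^ (D + m + 1) * (hStar P w).eval t ≤
          geomFactor (denominator Q) g t ^ (D + m + 1) * (hStar Q w).eval t := by
    -- The zero weight is homogeneous of every degree but has `totalDegree` 0, so the exponent in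
    -- `hStar` need not be D + m + 1; there everything vanishes.
    rcases eq_or_ne w 0 with rfl | hw0
    · have h : ∀ K : Set (Fin d → ℝ), hStar K 0 = 0 := fun K => hStar_eq_zero (ehrhartSeries_zero K)
      exact ⟨isHStar_of_eq_zero (ehrhartSeries_zero P), isHStar_of_eq_zero (ehrhartSeries_zero Q),
        fun _ _ _ _ _ _ => by simp [h]⟩
    obtain ⟨ξ, hξ, hspec⟩ := exists_common_direction hP hQ hPQ (hDP.trans hDQ.symm) hwm hw0
    obtain ⟨hP1, hP2⟩ := hspec P (by simp)
    obtain ⟨hQ1, hQ2⟩ := hspec Q (by simp)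
    refine ⟨hP1, hQ1, fun g hg hPg hQg t ht => ?_⟩
    have hdP := natDegree_hStar_le P w
    have hdQ := natDegree_hStar_le Q w
    rw [IsHStar] at hP1 hQ1
    rw [hwm.totalDegree hw0, hDP] at hP1 hdP
    rw [hwm.totalDegree hw0, hDQ] at hQ1 hdQ
    rw [hDP] at hP2
    rw [hDQ] at hQ2
    have hnonneg := cone_nonneg hwS hwm
    exact numerator_le_numerator hg hPg hQg hdP hdQ hP1 hP2 hQ1 hQ2
      (coeff_levelSeries_mono hQ.isCompact hnonneg (cone_mono hPQ) subset_rfl)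
      (coeff_levelSeries_mono hQ.isCompact hnonneg (dualCone_mono hPQ ξ) hξ) ht
  refine ⟨hmain.1, hmain.2.1, hmain.2.2, fun hden t ht => ?_⟩
  have hpos := hQ.denominator_spec.1
  -- With g = δ(Q) = δ(P) both geometric factors are 1.
  have h := hmain.2.2 _ hpos hden.dvd dvd_rfl t ht
  rwa [hden, WeightedEhrhart.geomFactor_self hpos, one_pow, one_mul, one_mul] at h
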